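/- For a nonempty compact set $\sigma\subseteq\mathbb{C}=\mathbb{R}^2$ and a finite ordered list $S=[x_0,\dots,x_n]$ of points of $\sigma$ (repetitions allowed) let $\mathrm{cvar}(f,S)=\sum_{i=1}^n|f(x_i)-f(x_{i-1})|$ for $f:\sigma\to\mathbb{C}$. For $n\ge 1$ and a line $\ell$ in the plane, the segment $\overline{x_i x_{i+1}}$ is called a crossing segment of $S$ on $\ell$ if (i) $x_i$ and $x_{i+1}$ lie strictly on opposite sides of $\ell$, or (ii) $i=0$ and $x_0\in\ell$, or (iii) $i>0$, $x_i\in\ell$ and $x_{i-1}\notin\ell$, or (iv) $i=n-1$, $x_i\notin\ell$ and $x_{i+1}\in\ell$. Let $\mathrm{vf}(S)$ be the maximum over all lines $\ell$ of the number of crossing segments of $S$ on $\ell$ (and $\mathrm{vf}(S)=1$ if $n=0$). Put $\mathrm{var}(f,\sigma)=\sup_S \mathrm{cvar}(f,S)/\mathrm{vf}(S)$ and $\|f\|_{BV(\sigma)}=\|f\|_\infty+\mathrm{var}(f,\sigma)$, and let $BV(\sigma)$ be the Banach algebra of all $f:\sigma\to\mathbb{C}$ with $\|f\|_{BV(\sigma)}<\infty$,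 under pointwise operations. Let $AC(\sigma)$ be the closure in $BV(\sigma)$ of the restrictions to $\sigma$ of the complex polynomials in the two real variables $x=\operatorname{Re}z$, $y=\operatorname{Im}z$. Write $AC(\sigma)\simeq AC(\tau)$ if there is an algebra isomorphism $\Phi:AC(\sigma)\to AC(\tau)$ such that $\Phi$ and $\Phi^{-1}$ are continuous (isomorphism as Banach algebras). A $C$-set is a countably infinite compact set $\sigma\subseteq\mathbb{C}$ whose unique limit point is $0$; it is a real $C$-set if $\sigma\subseteq\mathbb{R}$. For an integer $k\ge1$, a $C$-set $\sigma$ is a $k$-ray set if there are $k$ distinct rays $R_{\theta_j}=\{te^{i\theta_j}: t\ge 0\}$, $\theta_j\in[0,2\pi)$, such that $\sigma\cap R_{\theta_j}$ is infinite for each $j$ and $\sigma\setminus(R_{\theta_1}\cup\dots\cup R_{\theta_k})$ is finite. **Corollary.** There are exactly two isomorphism classes (with respect to $\simeq$) of spaces $AC(\sigma)$ with $\sigma$ a real $C$-set. More precisely: every real $C$-set is either a $1$-ray set or a $2$-ray set, and not both; and for real $C$-sets $\sigma$ and $\tau$, $AC(\sigma)\simeq AC(\tau)$ if and only if $\sigma$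 and $\tau$ are both $1$-ray sets or both $2$-ray sets. -/

import Mathlib

open scoped ENNReal

noncomputable section

namespace ACSpace

/-- A straight line `{(x, y) : a x + b y = c}` in the plane `ℂ = ℝ²`, given by an equation. -/
structure Line where
  a : ℝ
  b : ℝ
  c : ℝ
  nondeg : a ≠ 0 ∨ b ≠ 0

/-- The signed value of the equation of `ℓ` at `z`: it vanishes exactly on the line, and its sign
says on which side of the line `z` lies. -/
def Line.val (ℓ : Line) (z : ℂ) : ℝ := ℓ.a * z.re + ℓ.b * z.im - ℓ.c

/-- `z` lies on the line `ℓ`. -/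
def Line.On (ℓ : Line) (z : ℂ) : Prop := ℓ.val z = 0

/-- `z` and `w` lie on strictly opposite sides of `ℓ`. -/
def Line.Opposite (ℓ : Line) (z w : ℂ) : Prop := ℓ.val z * ℓ.val w < 0

/-- A finite ordered list `[x 0, x 1, …, x n]` of points is given by `n` and a sequence `x`, of which
only the first `n + 1` terms are used. `IsCrossing n x ℓ i` (for `i < n`) says that the segment
from `x i` to `x (i + 1)` is a crossing segment of the list on the line `ℓ`. -/
def IsCrossing (n : ℕ) (x : ℕ → ℂ) (ℓ : Line) (i : ℕ) : Prop :=
  ℓ.Opposite (x i) (x (i + 1)) ∨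
  (i = 0 ∧ ℓ.On (x i)) ∨
  (0 < i ∧ ℓ.On (x i) ∧ ¬ ℓ.On (x (i - 1))) ∨
  (i + 1 = n ∧ ¬ ℓ.On (x i) ∧ ℓ.On (x (i + 1)))

open Classical in
/-- The number of crossing segments of the list `[x 0, …, x n]` on `ℓ`; for a one-point list it is
`1` if the point is on `ℓ`, and `0` otherwise. -/
def vfLine (n : ℕ) (x : ℕ → ℂ) (ℓ : Line) : ℕ :=
  if n = 0 then (if ℓ.On (x 0) then 1 else 0)
  else ((Finset.range n).filter (fun i => IsCrossing n x ℓ i)).card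

theorem vfLine_le (n : ℕ) (x : ℕ → ℂ) (ℓ : Line) : vfLine n x ℓ ≤ n + 1 := by
  classical
  unfold vfLine
  split_ifs with h h'
  · omega
  · omega
  · exact (Finset.card_filter_le _ _).trans (by simp)

/-- The variation factor of the list `[x 0, …, x n]`: the maximum over all lines of the number of
crossing segments (a supremum of a bounded family of natural numbers). -/
def vf (n : ℕ) (x : ℕ → ℂ) : ℕ := ⨆ ℓ : Line, vfLine n x ℓ

theorem bddAbove_vfLine (n : ℕ) (x : ℕ → ℂ) : BddAbove (Set.range (vfLine n x)) :=
  ⟨n + 1, by rintro _ ⟨ℓ, rfl⟩; exact vfLine_le n x ℓ⟩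

/-- The variation factor is at least one, so that dividing by it is harmless. -/
theorem one_le_vf (n : ℕ) (x : ℕ → ℂ) : 1 ≤ vf n x := by
  classical
  let ℓ : Line := ⟨1, 0, (x 0).re, Or.inl one_ne_zero⟩
  have h0 : ℓ.On (x 0) := by simp [Line.On, Line.val, ℓ]
  refine le_trans ?_ (le_ciSup (bddAbove_vfLine n x) ℓ)
  unfold vfLine
  split_ifs with h
  · exact le_rfl
  · refine Finset.card_pos.mpr ⟨0, ?_⟩
    simp only [Finset.mem_filter, Finset.mem_range]
    exact ⟨Nat.pos_of_ne_zero h, Or.inr (Or.inl ⟨rfl, h0⟩)⟩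

variable {σ : Set ℂ}

/-- The curve variation of `f` on the list `[x 0, …, x n]`. -/
def cvar (f : σ → ℂ) (n : ℕ) (x : ℕ → σ) : ℝ≥0∞ :=
  ∑ i ∈ Finset.range n, ‖f (x (i + 1)) - f (x i)‖ₑ

/-- The two-dimensional variation of `f : σ → ℂ`, with values in `[0, ∞]`. -/
def var (f : σ → ℂ) : ℝ≥0∞ :=
  ⨆ (n : ℕ) (x : ℕ → σ), cvar f n x / (vf n (fun i => (x i : ℂ)) : ℝ≥0∞)

/-- The supremum norm, with values in `[0, ∞]`. -/
def supNorm (f : σ → ℂ) : ℝ≥0∞ := ⨆ z : σ, ‖f z‖ₑ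

/-- The variation norm `‖f‖_∞ + var(f, σ)`, with values in `[0, ∞]`. -/
def eBVNorm (f : σ → ℂ) : ℝ≥0∞ := supNorm f + var f

theorem var_const (c : ℂ) : var (fun _ : σ => c) = 0 := by
  simp [var, cvar]

theorem supNorm_const_le (c : ℂ) : supNorm (fun _ : σ => c) ≤ ‖c‖ₑ :=
  iSup_le fun _ => le_rfl

theorem eBVNorm_const_le (c : ℂ) : eBVNorm (fun _ : σ => c) ≤ ‖c‖ₑ := by
  rw [eBVNorm, var_const, add_zero]
  exact supNorm_const_le c

theorem le_supNorm (f : σ → ℂ) (z : σ) : ‖f z‖ₑ ≤ supNorm f := le_iSup (fun z => ‖f z‖ₑ) z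

theorem le_var (f : σ → ℂ) (n : ℕ) (x : ℕ → σ) :
    cvar f n x / (vf n (fun i => (x i : ℂ)) : ℝ≥0∞) ≤ var f :=
  le_iSup₂ (f := fun n (x : ℕ → σ) => cvar f n x / (vf n (fun i => (x i : ℂ)) : ℝ≥0∞)) n x

theorem eBVNorm_add_le (f g : σ → ℂ) : eBVNorm (f + g) ≤ eBVNorm f + eBVNorm g := by
  have h1 : supNorm (f + g) ≤ supNorm f + supNorm g :=
    iSup_le fun z => (enorm_add_le _ _).trans (add_le_add (le_supNorm f z) (le_supNorm g z))
  have h2 : var (f + g) ≤ var f + var g := by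
    refine iSup₂_le fun n x => ?_
    refine le_trans ?_ (add_le_add (le_var f n x) (le_var g n x))
    rw [← ENNReal.add_div]
    refine ENNReal.div_le_div_right ?_ _
    rw [cvar, cvar, cvar, ← Finset.sum_add_distrib]
    refine Finset.sum_le_sum fun i _ => ?_
    have : (f + g) (x (i + 1)) - (f + g) (x i)
        = (f (x (i + 1)) - f (x i)) + (g (x (i + 1)) - g (x i)) := by
      simp only [Pi.add_apply]; ring
    rw [this]
    exact enorm_add_le _ _
  calc eBVNorm (f + g) ≤ (supNorm f + supNorm g) + (var f + var g) := add_le_add h1 h2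
    _ = eBVNorm f + eBVNorm g := by unfold eBVNorm; ring

theorem eBVNorm_mul_le (f g : σ → ℂ) : eBVNorm (f * g) ≤ eBVNorm f * eBVNorm g := by
  have h1 : supNorm (f * g) ≤ supNorm f * supNorm g :=
    iSup_le fun z => by
      rw [Pi.mul_apply, enorm_mul]
      exact mul_le_mul' (le_supNorm f z) (le_supNorm g z)
  have h2 : var (f * g) ≤ supNorm f * var g + supNorm g * var f := by
    refine iSup₂_le fun n x => ?_
    refine le_trans ?_ (add_le_add (mul_le_mul_right (le_var g n x) _)
      (mul_le_mul_right (le_var f n x) _))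
    rw [← mul_div_assoc, ← mul_div_assoc, ← ENNReal.add_div]
    refine ENNReal.div_le_div_right ?_ _
    rw [cvar, cvar, cvar, Finset.mul_sum, Finset.mul_sum, ← Finset.sum_add_distrib]
    refine Finset.sum_le_sum fun i _ => ?_
    have : (f * g) (x (i + 1)) - (f * g) (x i)
        = f (x (i + 1)) * (g (x (i + 1)) - g (x i)) + g (x i) * (f (x (i + 1)) - f (x i)) := by
      simp only [Pi.mul_apply]; ring
    rw [this]
    refine (enorm_add_le _ _).trans ?_
    rw [enorm_mul, enorm_mul]
    exact add_le_add (mul_le_mul_left (le_supNorm f _) _) (mul_le_mul_left (le_supNorm g _) _)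
  calc eBVNorm (f * g)
      ≤ supNorm f * supNorm g + (supNorm f * var g + supNorm g * var f) := add_le_add h1 h2
    _ ≤ supNorm f * supNorm g + (supNorm f * var g + supNorm g * var f) + var f * var g :=
        le_self_add
    _ = eBVNorm f * eBVNorm g := by unfold eBVNorm; ring

theorem eBVNorm_neg (f : σ → ℂ) : eBVNorm (-f) = eBVNorm f := by
  have h : ∀ g : σ → ℂ, eBVNorm (-g) ≤ eBVNorm g := fun g => by
    have e : -g = (fun _ => (-1 : ℂ)) * g := by ext z; simp
    rw [e]
    refine (eBVNorm_mul_le _ _).trans ?_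
    calc _ ≤ ‖(-1 : ℂ)‖ₑ * eBVNorm g := mul_le_mul_left (eBVNorm_const_le _) _
      _ = eBVNorm g := by simp
  refine le_antisymm (h f) ?_
  simpa using h (-f)

variable (σ) in
/-- The functions of bounded variation on `σ`, as a subalgebra of all functions `σ → ℂ` under
pointwise operations. -/
def bvSubalgebra : Subalgebra ℂ (σ → ℂ) where
  carrier := {f | eBVNorm f < ∞}
  mul_mem' {f g} hf hg := (eBVNorm_mul_le f g).trans_lt (ENNReal.mul_lt_top hf hg)
  add_mem' {f g} hf hg := (eBVNorm_add_le f g).trans_lt (ENNReal.add_lt_top.2 ⟨hf, hg⟩)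
  algebraMap_mem' c := (eBVNorm_const_le (σ := σ) c).trans_lt enorm_lt_top

variable (σ) in
/-- The algebra `BV(σ)`. It is a type of its own, so that its only topology is the one given by the
variation norm (and not the topology of pointwise convergence). -/
def BV : Type := bvSubalgebra σ

instance : CommRing (BV σ) := inferInstanceAs (CommRing (bvSubalgebra σ))

instance : Algebra ℂ (BV σ) := inferInstanceAs (Algebra ℂ (bvSubalgebra σ))

/-- The inclusion of `BV(σ)` in the algebra of all functions `σ → ℂ`. -/
def BV.toFun : BV σ →ₐ[ℂ] (σ → ℂ) := (bvSubalgebra σ).val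

theorem BV.toFun_injective : Function.Injective (BV.toFun (σ := σ)) := Subtype.val_injective

theorem BV.eBVNorm_lt_top (f : BV σ) : eBVNorm f.toFun < ∞ := f.2

/-- The variation norm on `BV(σ)`. -/
instance : Norm (BV σ) := ⟨fun f => (eBVNorm f.toFun).toReal⟩

theorem BV.norm_def (f : BV σ) : ‖f‖ = (eBVNorm f.toFun).toReal := rfl

theorem BV.norm_mul_le' (f g : BV σ) : ‖f * g‖ ≤ ‖f‖ * ‖g‖ := by
  rw [norm_def, norm_def, norm_def, ← ENNReal.toReal_mul, map_mul]
  exact ENNReal.toReal_mono (ENNReal.mul_lt_top f.eBVNorm_lt_top g.eBVNorm_lt_top).ne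
    (eBVNorm_mul_le _ _)

/-- The additive group norm underlying the variation norm. -/
def BV.groupNorm : AddGroupNorm (BV σ) where
  toFun f := ‖f‖
  map_zero' := by
    rw [norm_def, map_zero]
    have := eBVNorm_const_le (σ := σ) 0
    simp only [enorm_zero, nonpos_iff_eq_zero] at this
    have h : eBVNorm (0 : σ → ℂ) = 0 := this
    simp [h]
  add_le' f g := by
    rw [norm_def, norm_def, norm_def, map_add,
      ← ENNReal.toReal_add f.eBVNorm_lt_top.ne g.eBVNorm_lt_top.ne]
    exact ENNReal.toReal_mono (ENNReal.add_lt_top.2 ⟨f.eBVNorm_lt_top, g.eBVNorm_lt_top⟩).ne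
      (eBVNorm_add_le _ _)
  neg' f := by rw [norm_def, norm_def, map_neg, eBVNorm_neg]
  eq_zero_of_map_eq_zero' f hf := by
    have h : eBVNorm f.toFun = 0 := by
      rcases (ENNReal.toReal_eq_zero_iff _).1 hf with h | h
      · exact h
      · exact absurd h f.eBVNorm_lt_top.ne
    apply BV.toFun_injective
    rw [map_zero]
    ext z
    have h1 : supNorm f.toFun = 0 := (add_eq_zero.1 h).1
    have h2 : ‖f.toFun z‖ₑ ≤ 0 := h1 ▸ le_supNorm f.toFun z
    simpa using h2

/-- `BV(σ)` as a normed algebra under the variation norm. -/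
instance : NormedCommRing (BV σ) :=
  { (inferInstance : Norm (BV σ)), (inferInstance : CommRing (BV σ)),
    BV.groupNorm.toNormedAddCommGroup with
    norm_mul_le := BV.norm_mul_le' }

instance : NormedAlgebra ℂ (BV σ) where
  norm_smul_le c f := by
    rw [Algebra.smul_def]
    refine (norm_mul_le _ _).trans (mul_le_mul_of_nonneg_right ?_ (norm_nonneg _))
    rw [BV.norm_def, ← toReal_enorm]
    refine ENNReal.toReal_mono enorm_ne_top ?_
    rw [AlgHom.commutes]
    exact eBVNorm_const_le c

variable (σ) in
/-- The restriction to `σ` of polynomials in the two real coordinates `x = Re z`, `y = Im z`, with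
complex coefficients. -/
def polyRestrict : MvPolynomial (Fin 2) ℂ →ₐ[ℂ] (σ → ℂ) :=
  MvPolynomial.aeval ![fun z : σ => ((z : ℂ).re : ℂ), fun z : σ => ((z : ℂ).im : ℂ)]

variable (σ) in
/-- `P₂(σ)`: the elements of `BV(σ)` that are restrictions of polynomials in `x` and `y`. (On a bounded
set the restriction of every such polynomial is of bounded variation.) -/
def Pol2 : Subalgebra ℂ (BV σ) := (polyRestrict σ).range.comap BV.toFun

variable (σ) in
/-- The algebra `AC(σ)` of absolutely continuous functions: the closure of `P₂(σ)` in `BV(σ)`, with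
the variation norm. -/
def AC : Subalgebra ℂ (BV σ) := (Pol2 σ).topologicalClosure

/-- `AC(σ) ≃ AC(τ)`, isomorphism as Banach algebras: there is an algebra isomorphism which is continuous
together with its inverse. -/
def ACIso (σ τ : Set ℂ) : Prop := Nonempty (AC σ ≃A[ℂ] AC τ)

/-- A `C`-set: a countably infinite compact subset of the plane whose unique limit point is `0`. -/
structure IsCSet (σ : Set ℂ) : Prop where
  isCompact : IsCompact σ
  countable : σ.Countable
  infinite : σ.Infinite
  accPt_iff : ∀ z : ℂ, AccPt z (Filter.principal σ) ↔ z = 0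

/-- A real `C`-set: a `C`-set contained in the real line. -/
structure IsRealCSet (σ : Set ℂ) : Prop extends IsCSet σ where
  real : ∀ z ∈ σ, z.im = 0

/-- The ray `{t e^{iθ} : t ≥ 0}`. -/
def ray (θ : ℝ) : Set ℂ := {z | ∃ t : ℝ, 0 ≤ t ∧ z = t * Complex.exp (θ * Complex.I)}

/-- `σ` is a `k`-ray set: a `C`-set with infinitely many points on each of `k ≥ 1` distinct rays from
the origin, and only finitely many points off these rays. -/
def IsRaySet (k : ℕ) (σ : Set ℂ) : Prop :=
  IsCSet σ ∧ 1 ≤ k ∧ ∃ θ : Fin k → ℝ,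
    (∀ j, θ j ∈ Set.Ico 0 (2 * Real.pi)) ∧ Function.Injective θ ∧
    (∀ j, (σ ∩ ray (θ j)).Infinite) ∧ (σ \ ⋃ j, ray (θ j)).Finite

/-- Isomorphism of the Banach algebras `AC(σ)`, as an equivalence relation on the real `C`-sets `σ`. -/
def realCSetSetoid : Setoid {σ : Set ℂ // IsRealCSet σ} where
  r σ τ := ACIso σ.1 τ.1
  iseqv :=
    { refl := fun _ => ⟨ContinuousAlgEquiv.refl ℂ _⟩
      symm := fun ⟨e⟩ => ⟨e.symm⟩
      trans := fun ⟨e⟩ ⟨e'⟩ => ⟨e.trans e'⟩ }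

end ACSpace

end

/-! For sets of reals the variation norm depends only on order. A monotone list has variation factor
one (`vf_eq_one_of_monotone_or_antitone`), and sorting an arbitrary list shows that monotone lists
already determine the two-dimensional variation (`var_le_of_forall_monotone`). Hence composition
with a monotone or antitone map does not increase the norm, and composition with a map that is
monotone off a finite set is bounded (`exists_eBVNorm_comp_le`). Moreover `AC(σ)` is the closed
unital algebra generated by the indicators of the nonzero points of `σ` (`IsRealCSet.AC_eq`), so a
bijection matching `0` with `0` and bounded in both directions induces an isomorphism
(`ACIso.of_equiv`).

Two sets accumulating at `0` from both sides are order isomorphic. A set accumulating from one side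
only is, after a reflection, a decreasing sequence with limit `0`, the point `0` and finitely many
negative points, so any two such sets are matched by a bijection that is monotone up to finitely
many points. This gives at most two classes.

Conversely, an algebra isomorphism permutes the indicators of nonzero points, which are minimal
idempotents, and so acts by composition there (`exists_point_map`, `apply_eq_of_map_acPoint`). If
`σ` accumulates from the right only and `τ` from both sides, the points of `σ` matched with positive
points of `τ` interleave near `0` with those matched with negative ones. Step functions on `τ`, all
of norm at most 3, then become functions on `σ` oscillating arbitrarily often, which contradicts
continuity (`not_acIso`). -/

namespace ACSpace

/-! ### Variation over subsets of the real line -/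

/-- A line meets a list along which its equation is monotone in at most one crossing segment. -/
theorem not_isCrossing_of_lt {n : ℕ} {x : ℕ → ℂ} {ℓ : Line} (hm : Monotone fun i => ℓ.val (x i))
    {i j : ℕ} (hij : i < j) (hj : j < n) (hi : IsCrossing n x ℓ i) : ¬ IsCrossing n x ℓ j := by
  have h1 : ℓ.val (x i) ≤ ℓ.val (x (i + 1)) := hm (Nat.le_succ i)
  have h2 : ℓ.val (x (i + 1)) ≤ ℓ.val (x j) := hm hij
  have h3 : ℓ.val (x j) ≤ ℓ.val (x (j + 1)) := hm (Nat.le_succ j)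
  have h4 : ℓ.val (x i) ≤ ℓ.val (x (j - 1)) := hm (by omega)
  have h5 : ℓ.val (x (j - 1)) ≤ ℓ.val (x j) := hm (by omega)
  -- After a crossing at `i` the list has either left `ℓ` for the positive side or was on `ℓ`
  -- already at `x i`. Crossings of type (iv) do not arise at `i`, which is not the last segment.
  have hz : 0 ≤ ℓ.val (x (i + 1)) ∧ (ℓ.val (x i) = 0 ∨ 0 < ℓ.val (x (i + 1))) := by
    rcases hi with h | ⟨-, h⟩ | ⟨-, h, -⟩ | ⟨h, -⟩
    · unfold Line.Opposite at h
      have : 0 < ℓ.val (x (i + 1)) := by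
        by_contra hc
        nlinarith
      exact ⟨this.le, Or.inr this⟩
    · unfold Line.On at h
      exact ⟨h ▸ h1, Or.inl h⟩
    · unfold Line.On at h
      exact ⟨h ▸ h1, Or.inl h⟩
    · omega
  rintro (h | ⟨h, -⟩ | ⟨-, h, h'⟩ | ⟨-, h, h'⟩)
  · unfold Line.Opposite at h
    nlinarith
  · omega
  · unfold Line.On at h h'
    rcases hz.2 with h0 | h0
    · exact h' (by linarith)
    · linarith
  · unfold Line.On at h h'
    rcases hz.2 with h0 | h0
    · exact h (by linarith)
    · linarith

theorem vfLine_le_one_of_monotone {n : ℕ} {x : ℕ → ℂ} {ℓ : Line}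
    (hm : Monotone fun i => ℓ.val (x i)) : vfLine n x ℓ ≤ 1 := by
  classical
  unfold vfLine
  split_ifs
  · exact le_rfl
  · exact zero_le_one
  · rw [Finset.card_le_one]
    intro i hi j hj
    simp only [Finset.mem_filter, Finset.mem_range] at hi hj
    rcases lt_trichotomy i j with h | h | h
    · exact absurd hj.2 (not_isCrossing_of_lt hm h hj.1 hi.2)
    · exact h
    · exact absurd hi.2 (not_isCrossing_of_lt hm h hi.1 hj.2)

/-- The same line, with the sign of its equation reversed. -/
def Line.neg (ℓ : Line) : Line :=
  ⟨-ℓ.a, -ℓ.b, -ℓ.c, ℓ.nondeg.imp neg_ne_zero.2 neg_ne_zero.2⟩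

theorem Line.neg_val (ℓ : Line) (z : ℂ) : ℓ.neg.val z = -ℓ.val z := by
  simp only [Line.val, Line.neg]; ring

theorem vfLine_neg (n : ℕ) (x : ℕ → ℂ) (ℓ : Line) : vfLine n x ℓ.neg = vfLine n x ℓ := by
  have h1 : ℓ.neg.On = ℓ.On := by
    ext z; simp only [Line.On, Line.neg_val, neg_eq_zero]
  have h2 : IsCrossing n x ℓ.neg = IsCrossing n x ℓ := by
    ext i; simp only [IsCrossing, Line.Opposite, h1, Line.neg_val, neg_mul_neg]
  unfold vfLine
  rw [h1, h2]

/-- On the real axis the equation of a line is affine in the real part, hence monotone or antitone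
along the list; reversing its sign leaves only the monotone case. -/
theorem vf_eq_one_of_monotone_or_antitone (n : ℕ) {x : ℕ → ℂ} (hx : ∀ i, (x i).im = 0)
    (hm : Monotone (fun i => (x i).re) ∨ Antitone (fun i => (x i).re)) : vf n x = 1 := by
  refine le_antisymm (ciSup_le' fun ℓ => ?_) (one_le_vf n x)
  have key : (Monotone fun i => ℓ.val (x i)) ∨ (Antitone fun i => ℓ.val (x i)) := by
    simp only [Line.val, hx, mul_zero, add_zero]
    rcases le_total 0 ℓ.a with ha | ha <;> rcases hm with hm | hm
    · exact Or.inl fun i j hij => sub_le_sub_right (mul_le_mul_of_nonneg_left (hm hij) ha) _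
    · exact Or.inr fun i j hij => sub_le_sub_right (mul_le_mul_of_nonneg_left (hm hij) ha) _
    · exact Or.inr fun i j hij => sub_le_sub_right (mul_le_mul_of_nonpos_left (hm hij) ha) _
    · exact Or.inl fun i j hij => sub_le_sub_right (mul_le_mul_of_nonpos_left (hm hij) ha) _
  rcases key with h | h
  · exact vfLine_le_one_of_monotone h
  · rw [← vfLine_neg]
    refine vfLine_le_one_of_monotone ?_
    simp only [Line.neg_val]
    exact h.neg

variable {σ τ : Set ℂ}

theorem cvar_le_var_of_monotone_or_antitone (hσ : ∀ z ∈ σ, z.im = 0) (f : σ → ℂ) (n : ℕ)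
    {x : ℕ → σ} (hm : Monotone (fun i => (x i : ℂ).re) ∨ Antitone (fun i => (x i : ℂ).re)) :
    cvar f n x ≤ var f := by
  have := le_var f n x
  rwa [vf_eq_one_of_monotone_or_antitone n (fun i => hσ _ (x i).2) hm, Nat.cast_one, div_one]
    at this

theorem enorm_sub_le_sum_Ico (g : ℕ → ℂ) {a b : ℕ} (hab : a ≤ b) :
    ‖g b - g a‖ₑ ≤ ∑ j ∈ Finset.Ico a b, ‖g (j + 1) - g j‖ₑ := by
  induction b, hab using Nat.le_induction with
  | base => simp
  | succ b hab ih =>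
    rw [Finset.sum_Ico_succ_top hab]
    calc ‖g (b + 1) - g a‖ₑ = ‖(g b - g a) + (g (b + 1) - g b)‖ₑ := by ring_nf
      _ ≤ _ := (enorm_add_le _ _).trans (add_le_add_left ih _)

open Classical in
/-- On a set of reals, the variation is controlled by the monotone lists. -/
theorem var_le_of_forall_monotone (hσ : ∀ z ∈ σ, z.im = 0) (f : σ → ℂ) (C : ℝ≥0∞)
    (h : ∀ (n : ℕ) (x : ℕ → σ), Monotone (fun i => (x i : ℂ).re) → cvar f n x ≤ C) :
    var f ≤ C := by
  refine iSup₂_le fun n x => ?_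
  refine ENNReal.div_le_of_le_mul' ?_
  set V := vf n (fun i => (x i : ℂ)) with hV
  rcases Nat.eq_zero_or_pos n with rfl | hn
  · simp [cvar]
  -- `y` is the list sorted by real part, extended by a constant beyond `n`, and `k i` is the rank
  -- of the point `x i` in it.
  let e : Equiv.Perm (Fin (n + 1)) := Tuple.sort fun i : Fin (n + 1) => (x i : ℂ).re
  let y : ℕ → σ := fun j => x (e ⟨min j n, by omega⟩)
  have hy : Monotone fun j => (y j : ℂ).re := by
    intro i j hij
    have := Tuple.monotone_sort (fun i : Fin (n + 1) => (x i : ℂ).re)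
    exact this (show (⟨min i n, by omega⟩ : Fin (n + 1)) ≤ ⟨min j n, by omega⟩ from
      min_le_min_right n hij)
  let k : ℕ → ℕ := fun i => (e.symm ⟨min i n, by omega⟩ : Fin (n + 1))
  have hk : ∀ i, k i ≤ n := fun i => Nat.lt_succ_iff.1 (e.symm ⟨min i n, by omega⟩).2
  have hxy : ∀ i, i ≤ n → x i = y (k i) := by
    intro i hi
    have : (⟨min (k i) n, by omega⟩ : Fin (n + 1)) = e.symm ⟨min i n, by omega⟩ := by
      ext; exact min_eq_left (hk i)
    simp only [y, this, Equiv.apply_symm_apply, min_eq_left hi]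
  let d : ℕ → ℝ≥0∞ := fun j => ‖f (y (j + 1)) - f (y j)‖ₑ
  -- The `i`-th step of the original list passes over the `j`-th gap of the sorted list.
  let P : ℕ → ℕ → Prop := fun i j =>
    (k i ≤ j ∧ j < k (i + 1)) ∨ (k (i + 1) ≤ j ∧ j < k i)
  have h1 : ∀ i ∈ Finset.range n, ‖f (x (i + 1)) - f (x i)‖ₑ
      ≤ ∑ j ∈ Finset.range n, if P i j then d j else 0 := by
    intro i hi
    have hi' := Finset.mem_range.1 hi
    rw [hxy i (by omega), hxy (i + 1) (by omega), ← Finset.sum_filter]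
    rcases le_total (k i) (k (i + 1)) with hle | hle
    · refine (enorm_sub_le_sum_Ico (fun j => f (y j)) hle).trans
        (Finset.sum_le_sum_of_subset fun j hj => ?_)
      have := hk (i + 1)
      simp only [Finset.mem_Ico, Finset.mem_filter, Finset.mem_range] at hj ⊢
      exact ⟨by omega, Or.inl hj⟩
    · rw [← enorm_neg, neg_sub]
      refine (enorm_sub_le_sum_Ico (fun j => f (y j)) hle).trans
        (Finset.sum_le_sum_of_subset fun j hj => ?_)
      have := hk i
      simp only [Finset.mem_Ico, Finset.mem_filter, Finset.mem_range] at hj ⊢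
      exact ⟨by omega, Or.inr hj⟩
  -- At most `V` steps pass over a gap of positive length, since each of them strictly crosses the
  -- vertical line through the midpoint of the gap. A gap of length zero contributes nothing.
  have h2 : ∀ j ∈ Finset.range n, (∑ i ∈ Finset.range n, if P i j then d j else 0) ≤ V * d j := by
    intro j _
    rcases (hy (Nat.le_succ j)).eq_or_lt with heq | hlt
    · have : y (j + 1) = y j :=
        Subtype.ext (Complex.ext heq.symm ((hσ _ (y (j + 1)).2).trans (hσ _ (y j).2).symm))
      simp [d, this]
    · rw [← Finset.sum_filter, Finset.sum_const, nsmul_eq_mul]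
      refine mul_le_mul_left (Nat.cast_le.2 ?_) _
      let ℓ : Line := ⟨1, 0, ((y j : ℂ).re + (y (j + 1) : ℂ).re) / 2, Or.inl one_ne_zero⟩
      refine le_trans ?_ (le_ciSup (bddAbove_vfLine n _) ℓ)
      rw [vfLine, if_neg hn.ne']
      refine Finset.card_le_card fun i hi => ?_
      simp only [Finset.mem_filter, Finset.mem_range] at hi ⊢
      refine ⟨hi.1, Or.inl ?_⟩
      simp only at hlt
      have hv : ∀ m, ℓ.val (y m) = (y m : ℂ).re - ((y j : ℂ).re + (y (j + 1) : ℂ).re) / 2 := by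
        intro m; simp [Line.val, ℓ]
      have hlow : ∀ m, m ≤ j → ℓ.val (y m) < 0 := fun m hm => by
        have := hy hm
        simp only at this
        rw [hv]; linarith
      have hhigh : ∀ m, j < m → 0 < ℓ.val (y m) := fun m hm => by
        have := hy (Nat.succ_le_of_lt hm)
        simp only [Nat.succ_eq_add_one] at this
        rw [hv]; linarith
      unfold Line.Opposite
      beta_reduce
      rw [hxy i (by omega), hxy (i + 1) (by omega)]
      rcases hi.2 with ⟨ha, hb⟩ | ⟨ha, hb⟩
      · exact mul_neg_of_neg_of_pos (hlow _ ha) (hhigh _ hb)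
      · exact mul_neg_of_pos_of_neg (hhigh _ hb) (hlow _ ha)
  calc cvar f n x ≤ ∑ i ∈ Finset.range n, ∑ j ∈ Finset.range n, if P i j then d j else 0 :=
        Finset.sum_le_sum h1
    _ = ∑ j ∈ Finset.range n, ∑ i ∈ Finset.range n, if P i j then d j else 0 := Finset.sum_comm
    _ ≤ ∑ j ∈ Finset.range n, V * d j := Finset.sum_le_sum h2
    _ = V * cvar f n y := by rw [← Finset.mul_sum]; rfl
    _ ≤ V * C := mul_le_mul_right (h n y hy) _

/-- Composition with a monotone or antitone map does not increase the variation norm. -/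
theorem eBVNorm_comp_le (hσ : ∀ z ∈ σ, z.im = 0) (hτ : ∀ z ∈ τ, z.im = 0) (g : τ → ℂ) {h : σ → τ}
    (hm : (∀ z w : σ, (z : ℂ).re ≤ (w : ℂ).re → (h z : ℂ).re ≤ (h w : ℂ).re) ∨
      (∀ z w : σ, (z : ℂ).re ≤ (w : ℂ).re → (h w : ℂ).re ≤ (h z : ℂ).re)) :
    eBVNorm (g ∘ h) ≤ eBVNorm g := by
  refine add_le_add (iSup_le fun z => le_supNorm g (h z)) ?_
  refine var_le_of_forall_monotone hσ _ _ fun n x hx => ?_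
  refine cvar_le_var_of_monotone_or_antitone hτ g n (x := fun i => h (x i)) ?_
  rcases hm with hm | hm
  · exact Or.inl fun i j hij => hm _ _ (hx hij)
  · exact Or.inr fun i j hij => hm _ _ (hx hij)

/-- A bounded monotone function has bounded variation. -/
theorem eBVNorm_ofReal_le (hσ : ∀ z ∈ σ, z.im = 0) {u : σ → ℝ} {M : ℝ}
    (hu : ∀ z w : σ, (z : ℂ).re ≤ (w : ℂ).re → u z ≤ u w) (hM : ∀ z, |u z| ≤ M) :
    eBVNorm (fun z => (u z : ℂ)) ≤ ENNReal.ofReal (3 * M) := by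
  rcases isEmpty_or_nonempty σ with hE | ⟨⟨z₀⟩⟩
  · have : eBVNorm (fun z => (u z : ℂ)) = 0 := by
      simp [eBVNorm, supNorm, var]
    simp [this]
  have hM0 : 0 ≤ M := (abs_nonneg _).trans (hM z₀)
  -- `M` bounds the supremum norm and `2 * M` the telescoping sum of increments along a monotone
  -- list.
  have e : 3 * M = M + 2 * M := by ring
  rw [e, ENNReal.ofReal_add hM0 (by positivity)]
  refine add_le_add (iSup_le fun z => ?_) (var_le_of_forall_monotone hσ _ _ fun n x hx => ?_)
  · rw [← ofReal_norm, Complex.norm_real]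
    exact ENNReal.ofReal_le_ofReal (hM z)
  · have h1 : ∀ i, ‖((u (x (i + 1)) : ℝ) : ℂ) - ((u (x i) : ℝ) : ℂ)‖ₑ
        = ENNReal.ofReal (u (x (i + 1)) - u (x i)) := fun i => by
      rw [← ofReal_norm, ← Complex.ofReal_sub, Complex.norm_real, Real.norm_eq_abs,
        abs_of_nonneg (sub_nonneg.2 (hu _ _ (hx (Nat.le_succ i))))]
    simp only [cvar, h1]
    rw [← ENNReal.ofReal_sum_of_nonneg
      fun i _ => sub_nonneg.2 (hu _ _ (hx (Nat.le_succ i))),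
      Finset.sum_range_sub (fun i => u (x i))]
    refine ENNReal.ofReal_le_ofReal ?_
    have := abs_le.1 (hM (x n))
    have := abs_le.1 (hM (x 0))
    linarith

theorem eBVNorm_ofReal_le' (hσ : ∀ z ∈ σ, z.im = 0) {u : σ → ℝ} {M : ℝ}
    (hu : ∀ z w : σ, (z : ℂ).re ≤ (w : ℂ).re → u w ≤ u z) (hM : ∀ z, |u z| ≤ M) :
    eBVNorm (fun z => (u z : ℂ)) ≤ ENNReal.ofReal (3 * M) := by
  have := eBVNorm_ofReal_le hσ (u := fun z => - u z) (M := M)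
    (fun z w h => neg_le_neg (hu z w h)) (fun z => by rw [abs_neg]; exact hM z)
  rw [← eBVNorm_neg]
  convert this using 2
  ext z
  simp

open Classical in
/-- The indicator function of a set of points, as a complex function. -/
noncomputable def ind (p : σ → Prop) : σ → ℂ := fun z => if p z then 1 else 0

theorem ind_mul (p q : σ → Prop) : ind p * ind q = ind fun z => p z ∧ q z := by
  ext z
  by_cases hp : p z <;> by_cases hq : q z <;> simp [ind, hp, hq]

theorem eBVNorm_ind_le (hσ : ∀ z ∈ σ, z.im = 0) {p : σ → Prop}
    (hp : (∀ z w : σ, (z : ℂ).re ≤ (w : ℂ).re → p z → p w) ∨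
      (∀ z w : σ, (z : ℂ).re ≤ (w : ℂ).re → p w → p z)) :
    eBVNorm (ind p) ≤ 3 := by
  classical
  have e : ind p = fun z => ((if p z then 1 else 0 : ℝ) : ℂ) := by
    ext z; by_cases h : p z <;> simp [ind, h]
  have hM : ∀ z, |(if p z then 1 else 0 : ℝ)| ≤ 1 := fun z => by split_ifs <;> simp
  have h3 : ENNReal.ofReal (3 * 1) = 3 := by norm_num
  rw [e, ← h3]
  rcases hp with hp | hp
  · refine eBVNorm_ofReal_le hσ (fun z w h => ?_) hM
    have := hp z w h
    split_ifs <;> simp_all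
  · refine eBVNorm_ofReal_le' hσ (fun z w h => ?_) hM
    have := hp z w h
    split_ifs <;> simp_all

theorem eBVNorm_ind_and_le (hσ : ∀ z ∈ σ, z.im = 0) {p q : σ → Prop}
    (hp : ∀ z w : σ, (z : ℂ).re ≤ (w : ℂ).re → p z → p w)
    (hq : ∀ z w : σ, (z : ℂ).re ≤ (w : ℂ).re → q w → q z) :
    eBVNorm (ind fun z => p z ∧ q z) ≤ 9 := by
  rw [← ind_mul]
  refine (eBVNorm_mul_le _ _).trans ?_
  calc _ ≤ (3 : ℝ≥0∞) * 3 :=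
        mul_le_mul' (eBVNorm_ind_le hσ (Or.inl hp)) (eBVNorm_ind_le hσ (Or.inr hq))
    _ = 9 := by norm_num

/-- A point is a degenerate interval, the intersection of two half-lines whose indicators have norm
at most 3. -/
theorem eBVNorm_ind_eq_le (hσ : ∀ z ∈ σ, z.im = 0) (x : σ) : eBVNorm (ind (· = x)) ≤ 9 := by
  have e : (fun z : σ => z = x) =
      fun z : σ => (x : ℂ).re ≤ (z : ℂ).re ∧ (z : ℂ).re ≤ (x : ℂ).re := by
    ext z
    refine ⟨fun h => by simp [h], fun h => Subtype.ext (Complex.ext (le_antisymm h.2 h.1) ?_)⟩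
    rw [hσ _ z.2, hσ _ x.2]
  rw [e]
  exact eBVNorm_ind_and_le hσ (fun z w h hz => hz.trans h) (fun z w h hw => h.trans hw)

/-! ### The algebra of absolutely continuous functions on a real `C`-set -/

/-- By compactness, infinitely many such points would accumulate at a point of norm at least `ε`,
but `0` is the only limit point. -/
theorem IsCSet.finite_le_norm (h : IsCSet σ) {ε : ℝ} (hε : 0 < ε) : {z ∈ σ | ε ≤ ‖z‖}.Finite := by
  by_contra hc
  obtain ⟨z, hz, hacc⟩ := Set.Infinite.exists_accPt_of_subset_isCompact (hs := hc)
    (h.isCompact.inter_right (isClosed_le continuous_const continuous_norm)) (fun z hz => hz)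
  have h0 : z = 0 := (h.accPt_iff z).1 (hacc.mono (Filter.principal_mono.2 fun z hz => hz.1))
  have := hz.2
  simp only [Set.mem_ofPred_eq, h0, norm_zero] at this
  linarith

theorem IsCSet.zero_mem (h : IsCSet σ) : (0 : ℂ) ∈ σ :=
  isClosed_iff_accPt.1 h.isCompact.isClosed 0 ((h.accPt_iff 0).2 rfl)

theorem IsCSet.exists_isolated (h : IsCSet σ) {x : ℂ} (hx : x ≠ 0) :
    ∃ δ > 0, ∀ z ∈ σ, z ≠ x → δ ≤ dist z x := by
  have h1 : ¬ AccPt x (Filter.principal σ) := fun hc => hx ((h.accPt_iff x).1 hc)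
  rw [accPt_iff_frequently, Filter.not_frequently, Metric.eventually_nhds_iff] at h1
  obtain ⟨δ, hδ, h2⟩ := h1
  refine ⟨δ, hδ, fun z hz hzx => ?_⟩
  by_contra hc
  exact h2 (not_le.1 hc) ⟨hzx, hz⟩

theorem IsCSet.exists_bound (h : IsCSet σ) : ∃ R > 0, ∀ z ∈ σ, |z.re| ≤ R := by
  obtain ⟨R, hR, h1⟩ := h.isCompact.isBounded.exists_pos_norm_le
  exact ⟨R, hR, fun z hz => (Complex.abs_re_le_norm z).trans (h1 z hz)⟩

/-- A function of finite variation norm, as an element of `BV(σ)`. -/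
def BV.mk (f : σ → ℂ) (hf : eBVNorm f < ∞) : BV σ := ⟨f, hf⟩

@[simp]
theorem BV.toFun_mk (f : σ → ℂ) (hf : eBVNorm f < ∞) : (BV.mk f hf).toFun = f := rfl

theorem BV.norm_le_of_eBVNorm_le {f : BV σ} {C : ℝ} (hC : 0 ≤ C)
    (h : eBVNorm f.toFun ≤ ENNReal.ofReal C) : ‖f‖ ≤ C :=
  ENNReal.toReal_le_of_le_ofReal hC h

theorem mem_topologicalClosure_of_forall {S : Subalgebra ℂ (BV σ)} {f : BV σ}
    (h : ∀ ε > 0, ∃ g ∈ S, eBVNorm (g.toFun - f.toFun) ≤ ENNReal.ofReal ε) :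
    f ∈ S.topologicalClosure := by
  change f ∈ closure (S : Set (BV σ))
  rw [Metric.mem_closure_iff]
  intro ε hε
  obtain ⟨g, hg, hgf⟩ := h (ε / 2) (by positivity)
  refine ⟨g, hg, ?_⟩
  rw [dist_comm, dist_eq_norm]
  rw [← map_sub] at hgf
  exact (BV.norm_le_of_eBVNorm_le (by positivity) hgf).trans_lt (by linarith)

theorem IsRealCSet.eBVNorm_re_lt_top (h : IsRealCSet σ) :
    eBVNorm (fun z : σ => ((z : ℂ).re : ℂ)) < ∞ := by
  obtain ⟨R, -, hR⟩ := h.exists_bound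
  exact (eBVNorm_ofReal_le h.real (u := fun z : σ => (z : ℂ).re) (fun z w h => h)
    (fun z => hR z z.2)).trans_lt ENNReal.ofReal_lt_top

/-- The coordinate function on a real `C`-set. -/
def IsRealCSet.reBV (h : IsRealCSet σ) : BV σ := BV.mk _ h.eBVNorm_re_lt_top

/-- The indicator function of a point of a real `C`-set. -/
noncomputable def IsRealCSet.point (h : IsRealCSet σ) (x : σ) : BV σ :=
  BV.mk (ind (· = x)) ((eBVNorm_ind_eq_le h.real x).trans_lt (by norm_num))

theorem IsRealCSet.point_apply_self (h : IsRealCSet σ) (x : σ) : (h.point x).toFun x = 1 := by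
  simp [point, ind]

theorem IsRealCSet.point_apply_of_ne (h : IsRealCSet σ) {x z : σ} (hz : z ≠ x) :
    (h.point x).toFun z = 0 := by
  simp [point, ind, hz]

/-- The algebra generated by the indicator functions of the isolated points. -/
def IsRealCSet.pointAlgebra (h : IsRealCSet σ) : Subalgebra ℂ (BV σ) :=
  Algebra.adjoin ℂ {f | ∃ x : σ, (x : ℂ) ≠ 0 ∧ f = h.point x}

theorem IsRealCSet.reBV_mem_Pol2 (h : IsRealCSet σ) : h.reBV ∈ Pol2 σ :=
  ⟨MvPolynomial.X 0, by simp [polyRestrict, reBV]⟩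

-- The polynomial `u = 1 - (Re z - Re x)² / (4R²)` is 1 at `x` and takes values in `[0, r]` with `r
-- < 1` on the rest of `σ`, because `x` is isolated. Its powers tend to the indicator of `x`
-- uniformly, and also in variation, since they are monotone on either side of `x`.
open Classical in
theorem IsRealCSet.point_mem_AC (h : IsRealCSet σ) {x : σ} (hx : (x : ℂ) ≠ 0) :
    h.point x ∈ AC σ := by
  obtain ⟨R, hR, hRσ⟩ := h.exists_bound
  obtain ⟨δ, hδ, hδσ⟩ := h.exists_isolated hx
  set u : σ → ℝ := fun z => 1 - ((z : ℂ).re - (x : ℂ).re) ^ 2 / (4 * R ^ 2) with hu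
  have hu0 : ∀ z, 0 ≤ u z := fun z => by
    have h1 := abs_le.1 (hRσ z z.2)
    have h2 := abs_le.1 (hRσ x x.2)
    rw [hu]
    simp only [sub_nonneg]
    rw [div_le_one (by positivity)]
    nlinarith
  have hur : ∀ z, z ≠ x → u z ≤ 1 - δ ^ 2 / (4 * R ^ 2) := fun z hz => by
    have h1 := hδσ z z.2 fun e => hz (Subtype.ext e)
    have h2 : dist (z : ℂ) x = |(z : ℂ).re - (x : ℂ).re| := by
      rw [Complex.dist_of_im_eq (by rw [h.real _ z.2, h.real _ x.2]), Real.dist_eq]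
    rw [h2] at h1
    have h3 : δ ^ 2 ≤ ((z : ℂ).re - (x : ℂ).re) ^ 2 := by
      rw [← sq_abs ((z : ℂ).re - (x : ℂ).re)]
      exact pow_le_pow_left₀ hδ.le h1 2
    simp only [hu]
    gcongr
  set r : ℝ := max 0 (1 - δ ^ 2 / (4 * R ^ 2)) with hr
  have hr0 : 0 ≤ r := le_max_left _ _
  have hr1 : r < 1 := max_lt one_pos (by
    have : 0 < δ ^ 2 / (4 * R ^ 2) := by positivity
    linarith)
  have hur' : ∀ z, z ≠ x → u z ≤ r := fun z hz => (hur z hz).trans (le_max_right _ _)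
  refine mem_topologicalClosure_of_forall fun ε hε => ?_
  -- The error has one part on each side of `x`, and each is a half-line indicator (norm at most 3)
  -- times a monotone function bounded by `r ^ n` (norm at most `3 * r ^ n`): `18 * r ^ n` in all.
  obtain ⟨n, hn⟩ := exists_pow_lt_of_lt_one (show 0 < ε / 18 by positivity) hr1
  refine ⟨(1 - algebraMap ℂ (BV σ) ((1 / (4 * R ^ 2) : ℝ) : ℂ) *
    (h.reBV - algebraMap ℂ (BV σ) ((x : ℂ).re : ℂ)) ^ 2) ^ n, ?_, ?_⟩
  · exact pow_mem (sub_mem (one_mem _) (mul_mem (Subalgebra.algebraMap_mem _ _)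
      (pow_mem (sub_mem h.reBV_mem_Pol2 (Subalgebra.algebraMap_mem _ _)) 2))) n
  -- `A` and `B` continue `u ^ n` from the left and from the right of `x` by the constant `r ^ n`,
  -- which keeps them monotone, respectively antitone, on all of `σ`.
  let A : σ → ℝ := fun z => if (z : ℂ).re < (x : ℂ).re then u z ^ n else r ^ n
  let B : σ → ℝ := fun z => if (x : ℂ).re < (z : ℂ).re then u z ^ n else r ^ n
  have hne1 : ∀ z : σ, (z : ℂ).re < (x : ℂ).re → z ≠ x := by rintro z hz rfl; exact hz.false
  have hne2 : ∀ z : σ, (x : ℂ).re < (z : ℂ).re → z ≠ x := by rintro z hz rfl; exact hz.false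
  have hA : eBVNorm (fun z => (A z : ℂ)) ≤ ENNReal.ofReal (3 * r ^ n) := by
    refine eBVNorm_ofReal_le h.real (fun z w hzw => ?_) (fun z => ?_)
    · simp only [A]
      split_ifs with h1 h2 h2
      · refine pow_le_pow_left₀ (hu0 z) ?_ n
        simp only [hu]
        gcongr ?_ - ?_ / _
        nlinarith
      · exact pow_le_pow_left₀ (hu0 z) (hur' z (hne1 z h1)) n
      · linarith
      · exact le_rfl
    · simp only [A]
      split_ifs with h1
      · rw [abs_of_nonneg (pow_nonneg (hu0 z) n)]
        exact pow_le_pow_left₀ (hu0 z) (hur' z (hne1 z h1)) n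
      · rw [abs_of_nonneg (pow_nonneg hr0 n)]
  have hB : eBVNorm (fun z => (B z : ℂ)) ≤ ENNReal.ofReal (3 * r ^ n) := by
    refine eBVNorm_ofReal_le' h.real (fun z w hzw => ?_) (fun z => ?_)
    · simp only [B]
      split_ifs with h1 h2 h2
      · refine pow_le_pow_left₀ (hu0 w) ?_ n
        simp only [hu]
        gcongr ?_ - ?_ / _
        nlinarith
      · exact pow_le_pow_left₀ (hu0 w) (hur' w (hne2 w h1)) n
      · linarith
      · exact le_rfl
    · simp only [B]
      split_ifs with h1
      · rw [abs_of_nonneg (pow_nonneg (hu0 z) n)]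
        exact pow_le_pow_left₀ (hu0 z) (hur' z (hne2 z h1)) n
      · rw [abs_of_nonneg (pow_nonneg hr0 n)]
  have key : BV.toFun ((1 - algebraMap ℂ (BV σ) ((1 / (4 * R ^ 2) : ℝ) : ℂ) *
      (h.reBV - algebraMap ℂ (BV σ) ((x : ℂ).re : ℂ)) ^ 2) ^ n) - (h.point x).toFun
      = ind (fun z : σ => (z : ℂ).re < (x : ℂ).re) * (fun z => (A z : ℂ)) +
        ind (fun z : σ => (x : ℂ).re < (z : ℂ).re) * (fun z => (B z : ℂ)) := by
    have e : BV.toFun ((1 - algebraMap ℂ (BV σ) ((1 / (4 * R ^ 2) : ℝ) : ℂ) *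
        (h.reBV - algebraMap ℂ (BV σ) ((x : ℂ).re : ℂ)) ^ 2) ^ n) = fun z => ((u z ^ n : ℝ) : ℂ) := by
      rw [map_pow, map_sub, map_one, map_mul, map_pow, map_sub, AlgHom.commutes, AlgHom.commutes]
      ext z
      simp only [reBV, BV.toFun_mk, hu, Pi.pow_apply, Pi.sub_apply, Pi.mul_apply, Pi.one_apply,
        Pi.algebraMap_apply, Algebra.algebraMap_self, RingHom.id_apply]
      push_cast
      ring
    rw [e]
    ext z
    simp only [Pi.sub_apply, Pi.add_apply, Pi.mul_apply, ind, A, B]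
    rcases lt_trichotomy (z : ℂ).re (x : ℂ).re with hz | hz | hz
    · simp [h.point_apply_of_ne (hne1 z hz), hz, hz.le]
    · have : z = x := Subtype.ext (Complex.ext hz (by rw [h.real _ z.2, h.real _ x.2]))
      subst this
      simp [h.point_apply_self, hu]
    · simp [h.point_apply_of_ne (hne2 z hz), hz, hz.le]
  rw [key]
  have h3 : (3 : ℝ≥0∞) = ENNReal.ofReal 3 := by norm_num
  calc _ ≤ (3 * ENNReal.ofReal (3 * r ^ n)) + (3 * ENNReal.ofReal (3 * r ^ n)) := by
        refine (eBVNorm_add_le _ _).trans (add_le_add ?_ ?_)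
        · exact (eBVNorm_mul_le _ _).trans (mul_le_mul' (eBVNorm_ind_le h.real
            (Or.inr fun z w h1 h2 => h1.trans_lt h2)) hA)
        · exact (eBVNorm_mul_le _ _).trans (mul_le_mul' (eBVNorm_ind_le h.real
            (Or.inl fun z w h1 h2 => h2.trans_le h1)) hB)
    _ = ENNReal.ofReal (18 * r ^ n) := by
        rw [h3, ← ENNReal.ofReal_mul (by norm_num), ← ENNReal.ofReal_add (by positivity)
          (by positivity)]
        ring_nf
    _ ≤ ENNReal.ofReal ε := ENNReal.ofReal_le_ofReal (by linarith)

theorem IsRealCSet.mem_pointAlgebra_of_finite (h : IsRealCSet σ) {f : BV σ}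
    (h0 : ∀ z : σ, (z : ℂ) = 0 → f.toFun z = 0) (hf : {z | f.toFun z ≠ 0}.Finite) :
    f ∈ h.pointAlgebra := by
  classical
  have e : f = ∑ x ∈ hf.toFinset, f.toFun x • h.point x := by
    apply BV.toFun_injective
    rw [map_sum]
    ext z
    rw [Finset.sum_apply]
    simp only [map_smul, Pi.smul_apply, smul_eq_mul]
    rw [Finset.sum_eq_single z, h.point_apply_self, mul_one]
    · intro x _ hx
      rw [h.point_apply_of_ne hx.symm, mul_zero]
    · intro hz
      simp only [Set.Finite.mem_toFinset, Set.mem_ofPred_eq, not_not] at hz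
      rw [hz, zero_mul]
  rw [e]
  refine Subalgebra.sum_mem _ fun x hx => Subalgebra.smul_mem _ (Algebra.subset_adjoin ?_) _
  exact ⟨x, fun hx0 => (hf.mem_toFinset.1 hx) (h0 x hx0), rfl⟩

/-- Replacing the coordinate by `0` on `(-ε, ε)` leaves a function of finite support. The error is
the coordinate clamped to `[-ε, ε]`, of norm at most `3 * ε`, times the indicator of an interval, of
norm at most 9. -/
theorem IsRealCSet.reBV_mem_closure (h : IsRealCSet σ) :
    h.reBV ∈ h.pointAlgebra.topologicalClosure := by
  refine mem_topologicalClosure_of_forall fun ε' hε' => ?_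
  obtain ⟨ε, hε, hεε⟩ : ∃ ε : ℝ, 0 < ε ∧ 27 * ε = ε' := ⟨ε' / 27, by positivity, by ring⟩
  have hb := eBVNorm_ind_and_le h.real (p := fun z : σ => -ε < (z : ℂ).re)
    (q := fun z : σ => (z : ℂ).re < ε) (fun z w h1 h2 => h2.trans_le h1)
    (fun z w h1 h2 => h1.trans_lt h2)
  set b : BV σ := BV.mk _ (hb.trans_lt (by norm_num)) with hbdef
  refine ⟨h.reBV * (1 - b), h.mem_pointAlgebra_of_finite (fun z hz => ?_) ?_, ?_⟩
  · simp [reBV, hz]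
  · refine ((h.finite_le_norm hε).preimage Subtype.val_injective.injOn).subset fun z hz => ?_
    refine ⟨z.2, le_trans ?_ (Complex.abs_re_le_norm z)⟩
    by_contra hc
    rw [not_le, abs_lt] at hc
    apply hz
    simp [hbdef, ind, hc]
  · have e : BV.toFun (h.reBV * (1 - b)) - h.reBV.toFun =
        -((fun z : σ => ((max (-ε) (min ε (z : ℂ).re) : ℝ) : ℂ)) * b.toFun) := by
      ext z
      rw [map_mul, map_sub, map_one]
      by_cases hz : -ε < (z : ℂ).re ∧ (z : ℂ).re < ε
      · have : max (-ε) (min ε (z : ℂ).re) = (z : ℂ).re := by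
          rw [min_eq_right hz.2.le, max_eq_right hz.1.le]
        simp [hbdef, ind, hz, reBV, this]
      · simp [hbdef, ind, hz, reBV]
    rw [e, eBVNorm_neg]
    refine (eBVNorm_mul_le _ _).trans ?_
    calc _ ≤ ENNReal.ofReal (3 * ε) * 9 := by
          refine mul_le_mul' (eBVNorm_ofReal_le h.real (fun z w hzw => by gcongr) fun z => ?_) hb
          exact abs_le.2 ⟨le_max_left _ _, max_le (by linarith) (min_le_left _ _)⟩
      _ = ENNReal.ofReal ε' := by
          rw [show (9 : ℝ≥0∞) = ENNReal.ofReal 9 by norm_num, ← ENNReal.ofReal_mul (by positivity),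
            ← hεε]
          ring_nf

/-- On a real `C`-set, the absolutely continuous functions are the limits of the combinations of
constants and indicator functions of isolated points. -/
theorem IsRealCSet.AC_eq (h : IsRealCSet σ) : AC σ = h.pointAlgebra.topologicalClosure := by
  refine le_antisymm (Subalgebra.topologicalClosure_minimal ?_ ?_)
    (Subalgebra.topologicalClosure_minimal (Algebra.adjoin_le ?_) ?_)
  · rintro f ⟨p, hp⟩
    -- The coordinate `y` vanishes on `σ`, so the restricted polynomials are polynomials in `h.reBV`
    -- alone.
    have e : polyRestrict σ = BV.toFun.comp (MvPolynomial.aeval ![h.reBV, 0]) := by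
      refine MvPolynomial.algHom_ext fun i => ?_
      fin_cases i
      · simp [polyRestrict, reBV]
      · ext z
        simp [polyRestrict, h.real z z.2]
    have hf : MvPolynomial.aeval ![h.reBV, 0] p = f := by
      apply BV.toFun_injective
      exact (DFunLike.congr_fun e p).symm.trans hp
    rw [← hf]
    have h1 : MvPolynomial.aeval ![h.reBV, 0] p ∈
        Algebra.adjoin ℂ (Set.range ![h.reBV, 0]) := by
      rw [Algebra.adjoin_range_eq_range_aeval]
      exact ⟨p, rfl⟩
    refine Algebra.adjoin_le ?_ h1
    rintro _ ⟨i, rfl⟩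
    fin_cases i
    · exact h.reBV_mem_closure
    · exact zero_mem _
  · exact Subalgebra.isClosed_topologicalClosure _
  · rintro _ ⟨x, hx, rfl⟩
    exact h.point_mem_AC hx
  · exact Subalgebra.isClosed_topologicalClosure _

/-! ### Isomorphisms induced by bijections -/

theorem enorm_apply_le_eBVNorm (f : σ → ℂ) (z : σ) : ‖f z‖ₑ ≤ eBVNorm f :=
  (le_supNorm f z).trans le_self_add

theorem eBVNorm_zero : eBVNorm (0 : σ → ℂ) = 0 := by
  have h : eBVNorm (fun _ : σ => (0 : ℂ)) ≤ 0 := by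
    simpa only [enorm_zero] using eBVNorm_const_le (σ := σ) 0
  exact nonpos_iff_eq_zero.1 h

theorem eBVNorm_sum_le {ι : Type*} (s : Finset ι) (f : ι → σ → ℂ) :
    eBVNorm (∑ i ∈ s, f i) ≤ ∑ i ∈ s, eBVNorm (f i) := by
  classical
  induction s using Finset.induction_on with
  | empty => simp [eBVNorm_zero]
  | insert i s hi ih =>
    rw [Finset.sum_insert hi, Finset.sum_insert hi]
    exact (eBVNorm_add_le _ _).trans (add_le_add_right ih _)

theorem eBVNorm_smul_le (c : ℂ) (f : σ → ℂ) : eBVNorm (c • f) ≤ ‖c‖ₑ * eBVNorm f :=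
  (eBVNorm_mul_le (fun _ => c) f).trans (mul_le_mul_left (eBVNorm_const_le c) _)

/-- Composition with a map that agrees with a monotone or antitone map off a finite set is bounded
in the variation norm. -/
theorem exists_eBVNorm_comp_le (hσ : ∀ z ∈ σ, z.im = 0) (hτ : ∀ z ∈ τ, z.im = 0) {h h' : σ → τ}
    (hfin : {z | h z ≠ h' z}.Finite)
    (hm : (∀ z w : σ, (z : ℂ).re ≤ (w : ℂ).re → (h' z : ℂ).re ≤ (h' w : ℂ).re) ∨
      (∀ z w : σ, (z : ℂ).re ≤ (w : ℂ).re → (h' w : ℂ).re ≤ (h' z : ℂ).re)) :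
    ∃ C : ℝ≥0∞, C ≠ ∞ ∧ ∀ g : τ → ℂ, eBVNorm (g ∘ h) ≤ C * eBVNorm g := by
  classical
  -- Each exceptional point adds a multiple of its indicator (norm at most 9), with a coefficient of
  -- modulus at most twice the norm of `g`.
  refine ⟨1 + hfin.toFinset.card * 18, by finiteness, fun g => ?_⟩
  have e : g ∘ h = g ∘ h' +
      ∑ x ∈ hfin.toFinset, (g (h x) - g (h' x)) • (ind (· = x) : σ → ℂ) := by
    ext z
    rw [Pi.add_apply, Finset.sum_apply]
    simp only [Pi.smul_apply, smul_eq_mul, Function.comp_apply]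
    rw [Finset.sum_eq_single z]
    · simp [ind]
    · intro x _ hx
      simp [ind, hx.symm]
    · intro hz
      simp only [Set.Finite.mem_toFinset, Set.mem_ofPred_eq, not_not] at hz
      simp [hz]
  rw [e, add_mul, one_mul]
  refine (eBVNorm_add_le _ _).trans (add_le_add (eBVNorm_comp_le hσ hτ g hm) ?_)
  refine (eBVNorm_sum_le _ _).trans ?_
  rw [mul_assoc, ← nsmul_eq_mul]
  refine Finset.sum_le_card_nsmul _ _ _ fun x _ => ?_
  refine (eBVNorm_smul_le _ _).trans ?_
  calc _ ≤ (eBVNorm g + eBVNorm g) * 9 :=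
        mul_le_mul' (enorm_sub_le.trans (add_le_add (enorm_apply_le_eBVNorm g _)
          (enorm_apply_le_eBVNorm g _))) (eBVNorm_ind_eq_le hσ x)
    _ = 18 * eBVNorm g := by ring

/-- Composition with a map `h : σ → τ`, as a homomorphism from `BV(τ)` to `BV(σ)`. -/
def BV.compHom (h : σ → τ) {C : ℝ≥0∞} (hC : C ≠ ∞)
    (hb : ∀ g : τ → ℂ, eBVNorm (g ∘ h) ≤ C * eBVNorm g) : BV τ →ₐ[ℂ] BV σ where
  toFun g := BV.mk (g.toFun ∘ h)
    ((hb g.toFun).trans_lt (ENNReal.mul_lt_top hC.lt_top g.eBVNorm_lt_top))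
  map_one' := rfl
  map_mul' _ _ := rfl
  map_zero' := rfl
  map_add' _ _ := rfl
  commutes' _ := rfl

@[simp]
theorem BV.toFun_compHom (h : σ → τ) {C : ℝ≥0∞} (hC : C ≠ ∞)
    (hb : ∀ g : τ → ℂ, eBVNorm (g ∘ h) ≤ C * eBVNorm g) (g : BV τ) :
    (BV.compHom h hC hb g).toFun = g.toFun ∘ h := rfl

theorem BV.continuous_compHom (h : σ → τ) {C : ℝ≥0∞} (hC : C ≠ ∞)
    (hb : ∀ g : τ → ℂ, eBVNorm (g ∘ h) ≤ C * eBVNorm g) :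
    Continuous (BV.compHom h hC hb) := by
  refine AddMonoidHomClass.continuous_of_bound (BV.compHom h hC hb) C.toReal fun g => ?_
  rw [BV.norm_def, BV.norm_def, ← ENNReal.toReal_mul]
  exact ENNReal.toReal_mono (ENNReal.mul_ne_top hC g.eBVNorm_lt_top.ne) (hb g.toFun)

/-- Composition with a bijection turns the indicator of `y` into that of `h.symm y`, so it carries
the generators of `AC τ` into `AC σ`, and continuity takes care of the closure. The condition on `0`
keeps nonzero points matched with nonzero points. -/
theorem compHom_mem_AC (hσ : IsRealCSet σ) (hτ : IsRealCSet τ) (h : σ ≃ τ)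
    (h0 : ∀ z : σ, (z : ℂ) = 0 → (h z : ℂ) = 0) {C : ℝ≥0∞} (hC : C ≠ ∞)
    (hb : ∀ g : τ → ℂ, eBVNorm (g ∘ h) ≤ C * eBVNorm g) {g : BV τ} (hg : g ∈ AC τ) :
    BV.compHom h hC hb g ∈ AC σ := by
  have key : AC τ ≤ (AC σ).comap (BV.compHom h hC hb) := by
    rw [hτ.AC_eq]
    refine Subalgebra.topologicalClosure_minimal (Algebra.adjoin_le ?_) ?_
    · rintro _ ⟨y, hy, rfl⟩
      have e : BV.compHom h hC hb (hτ.point y) = hσ.point (h.symm y) := by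
        apply BV.toFun_injective
        ext z
        have : h z = y ↔ z = h.symm y := by rw [Equiv.eq_symm_apply]
        simp [IsRealCSet.point, ind, this]
      change BV.compHom h hC hb (hτ.point y) ∈ AC σ
      rw [e]
      refine hσ.point_mem_AC fun hc => hy ?_
      simpa using h0 _ hc
    · exact (Subalgebra.isClosed_topologicalClosure _).preimage (BV.continuous_compHom h hC hb)
  exact key hg

theorem ACIso.of_equiv (hσ : IsRealCSet σ) (hτ : IsRealCSet τ) (h : σ ≃ τ)
    (h0 : ∀ z : σ, (z : ℂ) = 0 ↔ (h z : ℂ) = 0)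
    (hb : ∃ C : ℝ≥0∞, C ≠ ∞ ∧ ∀ g : τ → ℂ, eBVNorm (g ∘ h) ≤ C * eBVNorm g)
    (hb' : ∃ C : ℝ≥0∞, C ≠ ∞ ∧ ∀ g : σ → ℂ, eBVNorm (g ∘ h.symm) ≤ C * eBVNorm g) :
    ACIso σ τ := by
  obtain ⟨C, hC, hb⟩ := hb
  obtain ⟨C', hC', hb'⟩ := hb'
  have h0' : ∀ z : τ, (z : ℂ) = 0 → (h.symm z : ℂ) = 0 := fun z hz => (h0 _).2 (by simpa using hz)
  let F : AC τ →ₐ[ℂ] AC σ := ((BV.compHom h hC hb).comp (AC τ).val).codRestrict (AC σ)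
    fun g => compHom_mem_AC hσ hτ h (fun z => (h0 z).1) hC hb g.2
  let G : AC σ →ₐ[ℂ] AC τ := ((BV.compHom h.symm hC' hb').comp (AC σ).val).codRestrict (AC τ)
    fun g => compHom_mem_AC hτ hσ h.symm h0' hC' hb' g.2
  have hF : Continuous F := ((BV.continuous_compHom h hC hb).comp continuous_subtype_val).subtype_mk _
  have hG : Continuous G :=
    ((BV.continuous_compHom h.symm hC' hb').comp continuous_subtype_val).subtype_mk _
  have hGF : G.comp F = AlgHom.id ℂ (AC τ) := by
    refine AlgHom.ext fun g => Subtype.ext (BV.toFun_injective ?_)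
    ext z
    exact congrArg (BV.toFun (g : BV τ)) (h.apply_symm_apply z)
  have hFG : F.comp G = AlgHom.id ℂ (AC σ) := by
    refine AlgHom.ext fun g => Subtype.ext (BV.toFun_injective ?_)
    ext z
    exact congrArg (BV.toFun (g : BV σ)) (h.symm_apply_apply z)
  exact ⟨{ AlgEquiv.ofAlgHom G F hGF hFG with
    continuous_toFun := hG
    continuous_invFun := hF }⟩

/-! ### Isomorphisms and isolated points -/

/-- An idempotent takes the values 0 and 1. The one to be excluded is the indicator of `0`, which is
not even a uniform limit of elements of `h.pointAlgebra`. -/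
theorem IsRealCSet.exists_ne_zero_apply_ne_zero (h : IsRealCSet σ) {f : BV σ} (hf : f ∈ AC σ)
    (hid : f * f = f) (hne : f ≠ 0) : ∃ x : σ, (x : ℂ) ≠ 0 ∧ f.toFun x = 1 := by
  have h01 : ∀ z, f.toFun z = 0 ∨ f.toFun z = 1 := fun z => by
    have h1 : f.toFun z * f.toFun z = f.toFun z := by
      conv_rhs => rw [← hid]
      rw [map_mul, Pi.mul_apply]
    rcases eq_or_ne (f.toFun z) 0 with h2 | h2
    · exact Or.inl h2
    · exact Or.inr (mul_left_cancel₀ h2 (by rw [h1, mul_one]))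
  by_contra hc
  push Not at hc
  have hz : ∀ x : σ, (x : ℂ) ≠ 0 → f.toFun x = 0 := fun x hx => (h01 x).resolve_right (hc x hx)
  let o : σ := ⟨0, h.zero_mem⟩
  have ho : f.toFun o = 1 := by
    refine (h01 o).resolve_left fun h0 => hne ?_
    apply BV.toFun_injective
    ext x
    rw [map_zero, Pi.zero_apply]
    rcases eq_or_ne (x : ℂ) 0 with hx | hx
    · rw [← h0, show x = o from Subtype.ext hx]
    · exact hz x hx
  -- Elements of the point algebra take their value at `0` at all but finitely many points.
  have hconst : ∀ g ∈ h.pointAlgebra, {x : σ | g.toFun x ≠ g.toFun o}.Finite := by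
    intro g hg
    induction hg using Algebra.adjoin_induction with
    | mem g hg =>
      obtain ⟨x, hx, rfl⟩ := hg
      refine (Set.finite_singleton x).subset fun z hz => ?_
      by_contra hzx
      refine hz ?_
      rw [h.point_apply_of_ne hzx, h.point_apply_of_ne]
      rintro rfl
      exact hx rfl
    | algebraMap c => simp
    | add a b _ _ ha hb =>
      refine (ha.union hb).subset fun z hz => ?_
      by_contra hzx
      simp only [Set.mem_union, Set.mem_ofPred_eq, not_or, not_not] at hzx
      exact hz (by rw [map_add, Pi.add_apply, Pi.add_apply, hzx.1, hzx.2])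
    | mul a b _ _ ha hb =>
      refine (ha.union hb).subset fun z hz => ?_
      by_contra hzx
      simp only [Set.mem_union, Set.mem_ofPred_eq, not_or, not_not] at hzx
      exact hz (by rw [map_mul, Pi.mul_apply, Pi.mul_apply, hzx.1, hzx.2])
  rw [h.AC_eq] at hf
  have hf' : f ∈ closure (h.pointAlgebra : Set (BV σ)) := hf
  obtain ⟨g, hg, hfg⟩ := Metric.mem_closure_iff.1 hf' (1 / 2) (by norm_num)
  have hle : ∀ z, ‖f.toFun z - g.toFun z‖ < 1 / 2 := fun z => by
    refine lt_of_le_of_lt ?_ hfg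
    rw [dist_eq_norm, BV.norm_def, ← toReal_enorm]
    refine ENNReal.toReal_mono (f - g).eBVNorm_lt_top.ne ?_
    rw [map_sub]
    exact enorm_apply_le_eBVNorm (f.toFun - g.toFun) z
  have : Infinite σ := h.infinite.to_subtype
  obtain ⟨x, hx⟩ := ((hconst g hg).union (Set.finite_singleton o)).exists_notMem
  simp only [Set.mem_union, Set.mem_ofPred_eq, Set.mem_singleton_iff, not_or, not_not] at hx
  have h1 := hle x
  have h2 := hle o
  rw [hz x fun h0 => hx.2 (Subtype.ext h0), hx.1] at h1
  rw [ho] at h2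
  have h3 : ‖(1 : ℂ)‖ ≤ ‖(1 : ℂ) - g.toFun o‖ + ‖0 - g.toFun o‖ := by
    have := norm_sub_le ((1 : ℂ) - g.toFun o) (0 - g.toFun o)
    simpa using this
  rw [norm_one] at h3
  linarith

/-- The indicator function of an isolated point, as an element of `AC(σ)`. -/
noncomputable def IsRealCSet.acPoint (h : IsRealCSet σ) (x : σ) (hx : (x : ℂ) ≠ 0) : AC σ :=
  ⟨h.point x, h.point_mem_AC hx⟩

/-- This makes the indicator a minimal idempotent, and expresses evaluation at `x` through
multiplication alone, in a form that algebra isomorphisms respect. -/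
theorem IsRealCSet.mul_acPoint (h : IsRealCSet σ) (x : σ) (hx : (x : ℂ) ≠ 0) (f : AC σ) :
    f * h.acPoint x hx = (BV.toFun (f : BV σ) x) • h.acPoint x hx := by
  apply Subtype.ext
  apply BV.toFun_injective
  ext z
  by_cases hz : z = x <;> simp [acPoint, IsRealCSet.point, ind, hz]

theorem IsRealCSet.acPoint_ne_zero (h : IsRealCSet σ) (x : σ) (hx : (x : ℂ) ≠ 0) :
    h.acPoint x hx ≠ 0 := by
  intro hc
  have h1 : (h.point x).toFun x = 1 := h.point_apply_self x
  have h2 : h.point x = 0 := congrArg Subtype.val hc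
  rw [h2] at h1
  simp at h1

theorem IsRealCSet.acPoint_mul_self (h : IsRealCSet σ) (x : σ) (hx : (x : ℂ) ≠ 0) :
    h.acPoint x hx * h.acPoint x hx = h.acPoint x hx := by
  rw [h.mul_acPoint]
  change ((h.point x).toFun x) • _ = _
  rw [h.point_apply_self, one_smul]

/-- An isomorphism is implemented by a map of the isolated points. -/
theorem exists_point_map (hσ : IsRealCSet σ) (hτ : IsRealCSet τ) (Φ : AC σ ≃ₐ[ℂ] AC τ) (y : τ)
    (hy : (y : ℂ) ≠ 0) : ∃ x : σ, ∃ hx : (x : ℂ) ≠ 0, Φ (hσ.acPoint x hx) = hτ.acPoint y hy := by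
  set E : AC σ := Φ.symm (hτ.acPoint y hy) with hE
  have hEE : E * E = E := by rw [hE, ← map_mul, hτ.acPoint_mul_self]
  have hE0 : E ≠ 0 := by
    rw [hE, Ne, EmbeddingLike.map_eq_zero_iff]
    exact hτ.acPoint_ne_zero y hy
  obtain ⟨x, hx, hEx⟩ := hσ.exists_ne_zero_apply_ne_zero E.2 (congrArg Subtype.val hEE)
    (fun h => hE0 (Subtype.ext h))
  refine ⟨x, hx, ?_⟩
  have h1 : E * hσ.acPoint x hx = hσ.acPoint x hx := by rw [hσ.mul_acPoint, hEx, one_smul]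
  -- The image of the indicator of `x` lies below the indicator of `y`, hence is a multiple of it;
  -- being a nonzero idempotent, it has coefficient 1.
  have h2 : Φ (hσ.acPoint x hx) * hτ.acPoint y hy = Φ (hσ.acPoint x hx) := by
    conv_rhs => rw [← h1, map_mul, hE, AlgEquiv.apply_symm_apply, mul_comm]
  set F := Φ (hσ.acPoint x hx) with hF
  have hF0 : F ≠ 0 := by
    rw [hF, Ne, EmbeddingLike.map_eq_zero_iff]
    exact hσ.acPoint_ne_zero x hx
  have hFF : F * F = F := by rw [hF, ← map_mul, hσ.acPoint_mul_self]
  rw [hτ.mul_acPoint] at h2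
  set c := BV.toFun (F : BV τ) y with hc
  have hcc : c * c = c := by
    rw [hc, ← Pi.mul_apply, ← map_mul, ← Subalgebra.coe_mul, hFF]
  have hc0 : c ≠ 0 := fun h0 => hF0 (by rw [← h2, h0, zero_smul])
  have hc1 : c = 1 := mul_left_cancel₀ hc0 (by rw [hcc, mul_one])
  rw [← h2, hc1, one_smul]

/-- Multiplication by matching indicators reads off both values as coefficients. Thus `Φ.symm` acts
on values at nonzero points as composition with the point map. -/
theorem apply_eq_of_map_acPoint (hσ : IsRealCSet σ) (hτ : IsRealCSet τ) (Φ : AC σ ≃ₐ[ℂ] AC τ)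
    {x : σ} {y : τ} {hx : (x : ℂ) ≠ 0} {hy : (y : ℂ) ≠ 0}
    (h : Φ (hσ.acPoint x hx) = hτ.acPoint y hy) (g : AC τ) :
    BV.toFun (Φ.symm g : BV σ) x = BV.toFun (g : BV τ) y := by
  have h1 : Φ (Φ.symm g * hσ.acPoint x hx) = g * hτ.acPoint y hy := by
    rw [map_mul, AlgEquiv.apply_symm_apply, h]
  rw [hσ.mul_acPoint, hτ.mul_acPoint, map_smul, h] at h1
  exact smul_left_injective ℂ (hτ.acPoint_ne_zero y hy) h1

/-! ### Classification of real `C`-sets -/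

/-- `σ` has infinitely many points in the open right half plane. -/
def PosInfinite (σ : Set ℂ) : Prop := {z ∈ σ | 0 < z.re}.Infinite

/-- `σ` has infinitely many points in the open left half plane. -/
def NegInfinite (σ : Set ℂ) : Prop := {z ∈ σ | z.re < 0}.Infinite

theorem mem_ray_zero {z : ℂ} (hz : z.im = 0) : z ∈ ray 0 ↔ 0 ≤ z.re := by
  constructor
  · rintro ⟨t, ht, rfl⟩
    simpa using ht
  · intro h
    exact ⟨z.re, h, Complex.ext (by simp) (by simp [hz])⟩

theorem mem_ray_pi {z : ℂ} (hz : z.im = 0) : z ∈ ray Real.pi ↔ z.re ≤ 0 := by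
  constructor
  · rintro ⟨t, ht, rfl⟩
    simpa [Complex.exp_pi_mul_I] using ht
  · intro h
    exact ⟨-z.re, by linarith, Complex.ext (by simp [Complex.exp_pi_mul_I])
      (by simp [hz, Complex.exp_pi_mul_I])⟩

theorem eq_zero_or_eq_pi_of_mem_ray {z : ℂ} (hz : z.im = 0) (hz0 : z ≠ 0) {θ : ℝ}
    (hθ : θ ∈ Set.Ico 0 (2 * Real.pi)) (h : z ∈ ray θ) : θ = 0 ∨ θ = Real.pi := by
  obtain ⟨t, ht, rfl⟩ := h
  rw [Complex.im_ofReal_mul, Complex.exp_ofReal_mul_I_im] at hz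
  have ht0 : t ≠ 0 := by rintro rfl; simp at hz0
  obtain ⟨n, hn⟩ := Real.sin_eq_zero_iff.1 ((mul_eq_zero.1 hz).resolve_left ht0)
  have hpi := Real.pi_pos
  have h0 : -1 < n := by
    by_contra hc
    have : (n : ℝ) ≤ -1 := by exact_mod_cast not_lt.1 hc
    nlinarith [hθ.1]
  have h2 : n < 2 := by
    by_contra hc
    have : (2 : ℝ) ≤ n := by exact_mod_cast not_lt.1 hc
    nlinarith [hθ.2]
  obtain rfl | rfl : n = 0 ∨ n = 1 := by omega
  · left; simpa using hn.symm
  · right; simpa using hn.symm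

theorem eq_zero_or_eq_pi_of_infinite (hσ : ∀ z ∈ σ, z.im = 0) {θ : ℝ}
    (hθ : θ ∈ Set.Ico 0 (2 * Real.pi)) (h : (σ ∩ ray θ).Infinite) : θ = 0 ∨ θ = Real.pi := by
  obtain ⟨z, hz, hz0⟩ := h.exists_notMem_finite (Set.finite_singleton (0 : ℂ))
  exact eq_zero_or_eq_pi_of_mem_ray (hσ z hz.1) hz0 hθ hz.2

theorem inter_ray_zero_infinite_iff (hσ : ∀ z ∈ σ, z.im = 0) :
    (σ ∩ ray 0).Infinite ↔ PosInfinite σ := by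
  constructor
  · intro h hc
    refine h ((hc.union (Set.finite_singleton 0)).subset fun z hz => ?_)
    rcases ((mem_ray_zero (hσ z hz.1)).1 hz.2).eq_or_lt with h0 | h0
    · exact Or.inr (Complex.ext h0.symm (hσ z hz.1))
    · exact Or.inl ⟨hz.1, h0⟩
  · intro h
    exact h.mono fun z hz => ⟨hz.1, (mem_ray_zero (hσ z hz.1)).2 hz.2.le⟩

theorem inter_ray_pi_infinite_iff (hσ : ∀ z ∈ σ, z.im = 0) :
    (σ ∩ ray Real.pi).Infinite ↔ NegInfinite σ := by
  constructor
  · intro h hc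
    refine h ((hc.union (Set.finite_singleton 0)).subset fun z hz => ?_)
    rcases ((mem_ray_pi (hσ z hz.1)).1 hz.2).eq_or_lt with h0 | h0
    · exact Or.inr (Complex.ext h0 (hσ z hz.1))
    · exact Or.inl ⟨hz.1, h0⟩
  · intro h
    exact h.mono fun z hz => ⟨hz.1, (mem_ray_pi (hσ z hz.1)).2 hz.2.le⟩

theorem IsRealCSet.posInfinite_or_negInfinite (h : IsRealCSet σ) :
    PosInfinite σ ∨ NegInfinite σ := by
  by_contra hc
  simp only [PosInfinite, NegInfinite, not_or, Set.not_infinite] at hc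
  refine h.infinite (((hc.1.union hc.2).union (Set.finite_singleton 0)).subset fun z hz => ?_)
  rcases lt_trichotomy z.re 0 with h0 | h0 | h0
  · exact Or.inl (Or.inr ⟨hz, h0⟩)
  · exact Or.inr (Complex.ext h0 (h.real z hz))
  · exact Or.inl (Or.inl ⟨hz, h0⟩)

theorem zero_mem_Ico_two_pi : (0 : ℝ) ∈ Set.Ico 0 (2 * Real.pi) :=
  ⟨le_rfl, Real.two_pi_pos⟩

theorem pi_mem_Ico_two_pi : Real.pi ∈ Set.Ico 0 (2 * Real.pi) :=
  ⟨Real.pi_pos.le, by linarith [Real.pi_pos]⟩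

theorem IsRealCSet.isRaySet_two_iff (h : IsRealCSet σ) :
    IsRaySet 2 σ ↔ PosInfinite σ ∧ NegInfinite σ := by
  constructor
  · rintro ⟨-, -, θ, hθ, hinj, hinf, -⟩
    have hne : θ 0 ≠ θ 1 := fun hc => absurd (hinj hc) (by decide)
    have h0 := hinf 0
    have h1 := hinf 1
    rcases eq_zero_or_eq_pi_of_infinite h.real (hθ 0) h0 with e0 | e0 <;>
    rcases eq_zero_or_eq_pi_of_infinite h.real (hθ 1) h1 with e1 | e1
    · exact absurd (e0.trans e1.symm) hne
    · rw [e0] at h0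
      rw [e1] at h1
      exact ⟨(inter_ray_zero_infinite_iff h.real).1 h0, (inter_ray_pi_infinite_iff h.real).1 h1⟩
    · rw [e0] at h0
      rw [e1] at h1
      exact ⟨(inter_ray_zero_infinite_iff h.real).1 h1, (inter_ray_pi_infinite_iff h.real).1 h0⟩
    · exact absurd (e0.trans e1.symm) hne
  · rintro ⟨hp, hn⟩
    refine ⟨h.toIsCSet, by norm_num, ![0, Real.pi], ?_, ?_, ?_, ?_⟩
    · intro j
      fin_cases j
      · exact zero_mem_Ico_two_pi
      · exact pi_mem_Ico_two_pi
    · intro i j hij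
      have := Real.pi_ne_zero
      fin_cases i <;> fin_cases j <;> simp_all [eq_comm]
    · intro j
      fin_cases j
      · exact (inter_ray_zero_infinite_iff h.real).2 hp
      · exact (inter_ray_pi_infinite_iff h.real).2 hn
    · convert Set.finite_empty
      refine Set.eq_empty_of_forall_notMem fun z hz => hz.2 ?_
      rw [Set.mem_iUnion]
      rcases le_total 0 z.re with h0 | h0
      · exact ⟨0, (mem_ray_zero (h.real z hz.1)).2 h0⟩
      · exact ⟨1, (mem_ray_pi (h.real z hz.1)).2 h0⟩

/-- A single ray covers one side of `0` only, so the other side must be finite. Conversely, at least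
one side is always infinite, and if the other is finite one ray suffices. -/
theorem IsRealCSet.isRaySet_one_iff (h : IsRealCSet σ) :
    IsRaySet 1 σ ↔ ¬ (PosInfinite σ ∧ NegInfinite σ) := by
  constructor
  · rintro ⟨-, -, θ, hθ, -, hinf, hfin⟩ ⟨hp, hn⟩
    have h0 := hinf 0
    rcases eq_zero_or_eq_pi_of_infinite h.real (hθ 0) h0 with e0 | e0
    · refine hn (hfin.subset fun z hz => ⟨hz.1, fun hc => ?_⟩)
      obtain ⟨j, hj⟩ := Set.mem_iUnion.1 hc
      rw [Subsingleton.elim j 0, e0, mem_ray_zero (h.real z hz.1)] at hj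
      exact absurd hz.2 hj.not_gt
    · refine hp (hfin.subset fun z hz => ⟨hz.1, fun hc => ?_⟩)
      obtain ⟨j, hj⟩ := Set.mem_iUnion.1 hc
      rw [Subsingleton.elim j 0, e0, mem_ray_pi (h.real z hz.1)] at hj
      exact absurd hz.2 hj.not_gt
  · intro hnot
    rcases h.posInfinite_or_negInfinite with hp | hn
    · have hn : {z ∈ σ | z.re < 0}.Finite := Set.not_infinite.1 fun hn => hnot ⟨hp, hn⟩
      refine ⟨h.toIsCSet, le_rfl, fun _ => 0, fun _ => zero_mem_Ico_two_pi,
        Function.injective_of_subsingleton _,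
        fun _ => (inter_ray_zero_infinite_iff h.real).2 hp, hn.subset fun z hz => ⟨hz.1, ?_⟩⟩
      by_contra hc
      exact hz.2 (Set.mem_iUnion.2 ⟨0, (mem_ray_zero (h.real z hz.1)).2 (not_lt.1 hc)⟩)
    · have hp : {z ∈ σ | 0 < z.re}.Finite := Set.not_infinite.1 fun hp => hnot ⟨hp, hn⟩
      refine ⟨h.toIsCSet, le_rfl, fun _ => Real.pi, fun _ => pi_mem_Ico_two_pi,
        Function.injective_of_subsingleton _,
        fun _ => (inter_ray_pi_infinite_iff h.real).2 hn, hp.subset fun z hz => ⟨hz.1, ?_⟩⟩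
      by_contra hc
      exact hz.2 (Set.mem_iUnion.2 ⟨0, (mem_ray_pi (h.real z hz.1)).2 (not_lt.1 hc)⟩)

/-! ### Reflection -/

/-- The reflection of a set in the origin. -/
def reflect (σ : Set ℂ) : Set ℂ := {z | -z ∈ σ}

theorem accPt_reflect {z : ℂ} (h : AccPt z (Filter.principal σ)) :
    AccPt (-z) (Filter.principal (reflect σ)) := by
  rw [accPt_iff_frequently] at h ⊢
  refine (continuous_neg.tendsto z).frequently (h.mono fun y hy => ⟨?_, ?_⟩)
  · simpa using hy.1
  · simpa [reflect] using hy.2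

theorem reflect_reflect : reflect (reflect σ) = σ := by
  ext z; simp [reflect]

theorem IsRealCSet.reflect (h : IsRealCSet σ) : IsRealCSet (reflect σ) where
  isCompact := (Homeomorph.neg ℂ).isCompact_preimage.2 h.isCompact
  countable := h.countable.preimage neg_injective
  infinite := h.infinite.preimage fun z _ => ⟨-z, neg_neg z⟩
  accPt_iff z := by
    constructor
    · intro hz
      have := accPt_reflect hz
      rw [reflect_reflect, h.accPt_iff] at this
      simpa using this
    · rintro rfl
      simpa using accPt_reflect ((h.accPt_iff 0).2 rfl)
  real z hz := by simpa using h.real _ hz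

theorem IsRealCSet.acIso_reflect (h : IsRealCSet σ) : ACIso σ (ACSpace.reflect σ) := by
  let e : σ ≃ ACSpace.reflect σ :=
    { toFun := fun z => ⟨-z, by simp [ACSpace.reflect]⟩
      invFun := fun z => ⟨-z, z.2⟩
      left_inv := fun z => by simp
      right_inv := fun z => by simp }
  refine ACIso.of_equiv h h.reflect e (fun z => by simp [e]) ⟨1, ENNReal.one_ne_top, fun g => ?_⟩
    ⟨1, ENNReal.one_ne_top, fun g => ?_⟩
  · rw [one_mul]
    exact eBVNorm_comp_le h.real h.reflect.real g (Or.inr fun z w hzw => by simpa [e] using hzw)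
  · rw [one_mul]
    exact eBVNorm_comp_le h.reflect.real h.real g (Or.inr fun z w hzw => by simpa [e] using hzw)

theorem posInfinite_reflect : PosInfinite (reflect σ) ↔ NegInfinite σ := by
  constructor
  · refine fun h => (h.image neg_injective.injOn).mono ?_
    rintro _ ⟨z, hz, rfl⟩
    exact ⟨hz.1, by simpa using hz.2⟩
  · refine fun h => (h.image neg_injective.injOn).mono ?_
    rintro _ ⟨z, hz, rfl⟩
    exact ⟨by simpa [reflect] using hz.1, by simpa using hz.2⟩

theorem negInfinite_reflect : NegInfinite (reflect σ) ↔ PosInfinite σ := by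
  rw [← posInfinite_reflect, reflect_reflect]

/-- Reflection allows the infinite side of a one-sided set to be taken positive. -/
theorem IsRealCSet.exists_acIso_posInfinite (h : IsRealCSet σ)
    (h1 : ¬ (PosInfinite σ ∧ NegInfinite σ)) :
    ∃ ρ, IsRealCSet ρ ∧ PosInfinite ρ ∧ ¬ NegInfinite ρ ∧ ACIso σ ρ := by
  by_cases hp : PosInfinite σ
  · exact ⟨σ, h, hp, fun hn => h1 ⟨hp, hn⟩, ⟨ContinuousAlgEquiv.refl ℂ _⟩⟩
  · refine ⟨ACSpace.reflect σ, h.reflect, ?_, fun hc => hp (negInfinite_reflect.1 hc),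
      h.acIso_reflect⟩
    exact h.reflect.posInfinite_or_negInfinite.resolve_right
      fun hc => hp (negInfinite_reflect.1 hc)

/-! ### Enumerations -/

/-- Rank each point by the number of points above it. The rank is finite and strictly decreasing, so
`P` is order-reversed onto an infinite subset of `ℕ`, which is order isomorphic to `ℕ`. -/
theorem exists_strictAnti_range_eq {P : Set ℝ} (hP : P.Infinite)
    (hfin : ∀ x ∈ P, (P ∩ Set.Ioi x).Finite) : ∃ p : ℕ → ℝ, StrictAnti p ∧ Set.range p = P := by
  classical
  let φ : ℝ → ℕ := fun x => (P ∩ Set.Ioi x).ncard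
  have hφ : ∀ x ∈ P, ∀ y ∈ P, x < y → φ y < φ x := fun x hx y hy hxy =>
    Set.ncard_lt_ncard ⟨fun z hz => ⟨hz.1, hxy.trans hz.2⟩,
      fun hc => lt_irrefl y (hc ⟨hy, hxy⟩).2⟩ (hfin x hx)
  have hinj : Set.InjOn φ P := fun x hx y hy hxy => by
    rcases lt_trichotomy x y with h | h | h
    · exact absurd hxy (hφ x hx y hy h).ne'
    · exact h
    · exact absurd hxy (hφ y hy x hx h).ne
  have : Infinite (φ '' P) := (hP.image hinj).to_subtype
  let o := Nat.Subtype.orderIsoOfNat (φ '' P)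
  choose p hpP hpo using fun n => (o n).2
  refine ⟨p, fun n m hnm => ?_, Set.Subset.antisymm (Set.range_subset_iff.2 hpP) fun x hx => ?_⟩
  · have h1 : φ (p n) < φ (p m) := by
      rw [hpo, hpo]
      exact o.strictMono hnm
    by_contra hc
    rcases (not_lt.1 hc).eq_or_lt with h2 | h2
    · exact h1.ne (by rw [h2])
    · exact h1.not_gt (hφ _ (hpP n) _ (hpP m) h2)
  · obtain ⟨n, hn⟩ := o.surjective ⟨φ x, x, hx, rfl⟩
    refine ⟨n, hinj (hpP n) hx ?_⟩
    rw [hpo, hn]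

theorem IsRealCSet.exists_pos_enum (h : IsRealCSet σ) (hp : PosInfinite σ) :
    ∃ p : ℕ → ℝ, StrictAnti p ∧ (∀ n, 0 < p n ∧ (p n : ℂ) ∈ σ) ∧
      ∀ z ∈ σ, 0 < z.re → ∃ n, z = p n := by
  have hz : ∀ z ∈ σ, ((z.re : ℝ) : ℂ) = z := fun z hz =>
    Complex.ext (by simp) (by simp [h.real z hz])
  obtain ⟨p, hp1, hp2⟩ := exists_strictAnti_range_eq (P := {x : ℝ | (x : ℂ) ∈ σ ∧ 0 < x})
    (fun hc => hp ((hc.image Complex.ofReal).subset fun z hz' =>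
      ⟨z.re, ⟨(hz z hz'.1).symm ▸ hz'.1, hz'.2⟩, hz z hz'.1⟩))
    (fun x hx => ((h.finite_le_norm hx.2).preimage Complex.ofReal_injective.injOn).subset
      fun y hy => ⟨hy.1.1, by
        rw [Complex.norm_real, Real.norm_eq_abs]
        exact hy.2.le.trans (le_abs_self y)⟩)
  refine ⟨p, hp1, fun n => ?_, fun z hzσ hz0 => ?_⟩
  · have : p n ∈ {x : ℝ | (x : ℂ) ∈ σ ∧ 0 < x} := hp2 ▸ Set.mem_range_self n
    exact this.symm
  · have : z.re ∈ Set.range p := hp2 ▸ ⟨(hz z hzσ).symm ▸ hzσ, hz0⟩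
    obtain ⟨n, hn⟩ := this
    exact ⟨n, by rw [hn, hz z hzσ]⟩

/-- Matching two enumerations of the isolated points. -/
theorem exists_equiv_of_enum {ι : Type*} (h0σ : (0 : ℂ) ∈ σ) (h0τ : (0 : ℂ) ∈ τ) {e e' : ι → ℂ}
    (he : Function.Injective e) (he' : Function.Injective e') (hr : Set.range e = σ \ {0})
    (hr' : Set.range e' = τ \ {0}) :
    ∃ h : σ ≃ τ, (∀ z : σ, (z : ℂ) = 0 ↔ (h z : ℂ) = 0) ∧
      ∀ (z : σ) (i : ι), (z : ℂ) = e i ↔ (h z : ℂ) = e' i := by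
  have key : ∀ {ρ : Set ℂ} {d : ι → ℂ}, (0 : ℂ) ∈ ρ → Function.Injective d →
      Set.range d = ρ \ {0} → ∃ f : Option ι ≃ ρ, (f none : ℂ) = 0 ∧ ∀ i, (f (some i) : ℂ) = d i := by
    intro ρ d h0 hd hrd
    have hdm : ∀ i, d i ∈ ρ \ {0} := fun i => hrd ▸ Set.mem_range_self i
    let f : Option ι → ρ := fun o => o.elim ⟨0, h0⟩ fun i => ⟨d i, (hdm i).1⟩
    refine ⟨Equiv.ofBijective f ⟨?_, ?_⟩, rfl, fun i => rfl⟩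
    · rintro (_ | i) (_ | j) hij
      · rfl
      · exact absurd (congrArg Subtype.val hij).symm (hdm j).2
      · exact absurd (congrArg Subtype.val hij) (hdm i).2
      · exact congrArg some (hd (congrArg Subtype.val hij))
    · intro z
      rcases eq_or_ne (z : ℂ) 0 with hz | hz
      · exact ⟨none, Subtype.ext hz.symm⟩
      · have : (z : ℂ) ∈ Set.range d := hrd ▸ ⟨z.2, hz⟩
        obtain ⟨i, hi⟩ := this
        exact ⟨some i, Subtype.ext hi⟩
  obtain ⟨f, hf0, hf⟩ := key h0σ he hr
  obtain ⟨f', hf0', hf'⟩ := key h0τ he' hr'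
  refine ⟨f.symm.trans f', fun z => ?_, fun z i => ?_⟩
  · conv_lhs => rw [← hf0]
    conv_rhs => rw [← hf0']
    rw [Subtype.coe_inj, Subtype.coe_inj, Equiv.trans_apply, f'.apply_eq_iff_eq,
      Equiv.symm_apply_eq]
  · rw [← hf, ← hf', Subtype.coe_inj, Subtype.coe_inj, Equiv.trans_apply, f'.apply_eq_iff_eq,
      Equiv.symm_apply_eq]

/-- An enumeration of the isolated points, outside in on both sides of the origin. -/
structure IsTwoSidedEnum (σ : Set ℂ) (e : ℕ ⊕ ℕ → ℂ) : Prop where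
  injective : Function.Injective e
  range_eq : Set.range e = σ \ {0}
  pos : ∀ n, 0 < (e (Sum.inl n)).re
  neg : ∀ n, (e (Sum.inr n)).re < 0
  strictAnti : StrictAnti fun n => (e (Sum.inl n)).re
  strictMono : StrictMono fun n => (e (Sum.inr n)).re

theorem IsRealCSet.exists_isTwoSidedEnum (h : IsRealCSet σ) (hp : PosInfinite σ)
    (hn : NegInfinite σ) : ∃ e, IsTwoSidedEnum σ e := by
  obtain ⟨p, hp1, hp2, hp3⟩ := h.exists_pos_enum hp
  obtain ⟨q, hq1, hq2, hq3⟩ := h.reflect.exists_pos_enum (posInfinite_reflect.2 hn)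
  refine ⟨Sum.elim (fun n => (p n : ℂ)) (fun n => -(q n : ℂ)), ?_, ?_, fun n => by simp [hp2],
    fun n => by simp [hq2], fun n m hnm => by simpa using hp1 hnm,
    fun n m hnm => by simpa using hq1 hnm⟩
  · refine Function.Injective.sumElim (Complex.ofReal_injective.comp hp1.injective)
      (neg_injective.comp (Complex.ofReal_injective.comp hq1.injective)) fun n m hnm => ?_
    have h1 := congrArg Complex.re hnm
    simp only [Complex.ofReal_re, Complex.neg_re] at h1
    linarith [(hp2 n).1, (hq2 m).1]
  · refine Set.Subset.antisymm ?_ fun z hz => ?_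
    · rintro _ ⟨n | n, rfl⟩
      · exact ⟨(hp2 n).2, by simpa using (hp2 n).1.ne'⟩
      · exact ⟨(hq2 n).2, by simpa using (hq2 n).1.ne'⟩
    · rcases lt_trichotomy z.re 0 with h0 | h0 | h0
      · obtain ⟨n, hn⟩ := hq3 (-z) (by simpa [ACSpace.reflect] using hz.1) (by simpa using h0)
        exact ⟨Sum.inr n, by simp [← hn]⟩
      · exact absurd (Complex.ext h0 (h.real z hz.1)) hz.2
      · obtain ⟨n, hn⟩ := hp3 z hz.1 h0
        exact ⟨Sum.inl n, hn.symm⟩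

/-- Both sets are ordered alike: a sequence increasing to `0`, then `0`, then a sequence decreasing
to `0` read backwards. -/
theorem IsTwoSidedEnum.monotone {e e' : ℕ ⊕ ℕ → ℂ} (he : IsTwoSidedEnum σ e)
    (he' : IsTwoSidedEnum τ e') {h : σ → τ} (h0 : ∀ z : σ, (z : ℂ) = 0 → (h z : ℂ) = 0)
    (h1 : ∀ (z : σ) i, (z : ℂ) = e i → (h z : ℂ) = e' i) (z w : σ)
    (hzw : (z : ℂ).re ≤ (w : ℂ).re) : (h z : ℂ).re ≤ (h w : ℂ).re := by
  have hcases : ∀ z : σ, (z : ℂ) = 0 ∨ ∃ i, (z : ℂ) = e i := fun z => by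
    rcases eq_or_ne (z : ℂ) 0 with hz | hz
    · exact Or.inl hz
    · have : (z : ℂ) ∈ Set.range e := he.range_eq ▸ ⟨z.2, hz⟩
      obtain ⟨i, hi⟩ := this
      exact Or.inr ⟨i, hi.symm⟩
  -- Of the nine sign combinations, `skip` marks the three that are incompatible with `hzw`.
  rcases hcases z with hz | ⟨i | i, hz⟩ <;> rcases hcases w with hw | ⟨j | j, hw⟩ <;>
    [rw [h0 z hz, h0 w hw]; rw [h0 z hz, h1 w _ hw]; skip; skip; rw [h1 z _ hz, h1 w _ hw];
      skip; rw [h1 z _ hz, h0 w hw]; rw [h1 z _ hz, h1 w _ hw]; rw [h1 z _ hz, h1 w _ hw]]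
  · exact (he'.pos j).le
  · rw [hz, hw] at hzw; exact absurd hzw (he.neg j).not_ge
  · rw [hz, hw] at hzw; exact absurd hzw (he.pos i).not_ge
  · rw [hz, hw] at hzw
    exact he'.strictAnti.antitone (he.strictAnti.le_iff_ge.1 hzw)
  · rw [hz, hw] at hzw; exact absurd hzw ((he.neg j).trans (he.pos i)).not_ge
  · exact (he'.neg i).le
  · exact ((he'.neg i).trans (he'.pos j)).le
  · rw [hz, hw] at hzw
    exact he'.strictMono.monotone (he.strictMono.le_iff_le.1 hzw)

/-- Any two real `C`-sets accumulating at `0` from both sides have isomorphic algebras. -/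
theorem acIso_of_posInfinite_negInfinite (hσ : IsRealCSet σ) (hτ : IsRealCSet τ)
    (hσ' : PosInfinite σ ∧ NegInfinite σ) (hτ' : PosInfinite τ ∧ NegInfinite τ) :
    ACIso σ τ := by
  obtain ⟨e, he⟩ := hσ.exists_isTwoSidedEnum hσ'.1 hσ'.2
  obtain ⟨e', he'⟩ := hτ.exists_isTwoSidedEnum hτ'.1 hτ'.2
  obtain ⟨h, h0, h1⟩ := exists_equiv_of_enum hσ.zero_mem hτ.zero_mem he.injective he'.injective
    he.range_eq he'.range_eq
  refine ACIso.of_equiv hσ hτ h h0 ⟨1, ENNReal.one_ne_top, fun g => ?_⟩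
    ⟨1, ENNReal.one_ne_top, fun g => ?_⟩
  · rw [one_mul]
    exact eBVNorm_comp_le hσ.real hτ.real g (Or.inl (he.monotone he' (fun z => (h0 z).1)
      fun z i => (h1 z i).1))
  · rw [one_mul]
    refine eBVNorm_comp_le hτ.real hσ.real g (Or.inl (he'.monotone he (fun z hz => ?_)
      fun z i hz => ?_))
    · exact (h0 _).2 (by rwa [h.apply_symm_apply])
    · exact (h1 _ i).2 (by rwa [h.apply_symm_apply])

/-- An enumeration of the isolated points, in which all but the first `k` are positive and come
outside in. -/
structure IsOneSidedEnum (σ : Set ℂ) (k : ℕ) (e : ℕ → ℂ) : Prop where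
  injective : Function.Injective e
  range_eq : Set.range e = σ \ {0}
  pos : ∀ n, k ≤ n → 0 < (e n).re
  neg : ∀ n, n < k → (e n).re < 0
  strictAntiOn : StrictAntiOn (fun n => (e n).re) (Set.Ici k)

theorem IsRealCSet.exists_isOneSidedEnum (h : IsRealCSet σ) (hp : PosInfinite σ)
    (hn : ¬ NegInfinite σ) : ∃ k e, IsOneSidedEnum σ k e := by
  classical
  obtain ⟨p, hp1, hp2, hp3⟩ := h.exists_pos_enum hp
  have hN := Set.not_infinite.1 hn
  let f := hN.toFinset.equivFin.symm
  set k := hN.toFinset.card with hk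
  have hf : ∀ i, (f i : ℂ) ∈ σ ∧ (f i : ℂ).re < 0 := fun i =>
    hN.mem_toFinset.1 (f i).2
  let e : ℕ → ℂ := fun n => if hn : n < k then (f ⟨n, hn⟩ : ℂ) else p (n - k)
  have e1 : ∀ n (hn : n < k), e n = f ⟨n, hn⟩ := fun n hn => dif_pos hn
  have e2 : ∀ n, k ≤ n → e n = p (n - k) := fun n hn => dif_neg hn.not_gt
  have hpos : ∀ n, k ≤ n → 0 < (e n).re := fun n hn => by simp [e2 n hn, hp2]
  have hneg : ∀ n, n < k → (e n).re < 0 := fun n hn => by simp [e1 n hn, hf]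
  refine ⟨k, e, fun n m hnm => ?_, Set.Subset.antisymm ?_ fun z hz => ?_, hpos, hneg,
    fun n hn m hm hnm => ?_⟩
  · rcases lt_or_ge n k with h1 | h1 <;> rcases lt_or_ge m k with h2 | h2
    · rw [e1 n h1, e1 m h2, Subtype.coe_inj, f.apply_eq_iff_eq] at hnm
      exact Fin.mk.inj_iff.1 hnm
    · have := hneg n h1
      rw [hnm] at this
      exact absurd this (hpos m h2).not_gt
    · have := hneg m h2
      rw [← hnm] at this
      exact absurd this (hpos n h1).not_gt
    · rw [e2 n h1, e2 m h2, Complex.ofReal_inj] at hnm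
      have := hp1.injective hnm
      omega
  · rintro _ ⟨n, rfl⟩
    rcases lt_or_ge n k with h1 | h1
    · refine ⟨by rw [e1 n h1]; exact (hf _).1, fun hc => ?_⟩
      have := hneg n h1
      rw [show e n = 0 from hc] at this
      simp at this
    · refine ⟨by rw [e2 n h1]; exact (hp2 _).2, fun hc => ?_⟩
      have := hpos n h1
      rw [show e n = 0 from hc] at this
      simp at this
  · rcases lt_trichotomy z.re 0 with h0 | h0 | h0
    · obtain ⟨i, hi⟩ := f.surjective ⟨z, by simpa using ⟨hz.1, h0⟩⟩
      exact ⟨i, by rw [e1 i i.2, Fin.eta, hi]⟩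
    · exact absurd (Complex.ext h0 (h.real z hz.1)) hz.2
    · obtain ⟨n, hn⟩ := hp3 z hz.1 h0
      exact ⟨n + k, by rw [e2 _ (by omega), hn, Nat.add_sub_cancel]⟩
  · simp only [e2 n hn, e2 m hm, Complex.ofReal_re]
    rw [Set.mem_Ici] at hn
    exact hp1 (by omega)

/-- The two sets may have different numbers of negative points, so the matching is not monotone; it
is so only beyond a finite initial segment of the enumeration, which is enough for boundedness. -/
theorem IsOneSidedEnum.exists_eBVNorm_comp_le (hσ : IsRealCSet σ) (hτ : IsRealCSet τ) {k k' : ℕ}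
    {e e' : ℕ → ℂ} (he : IsOneSidedEnum σ k e) (he' : IsOneSidedEnum τ k' e') {h : σ → τ}
    (h0 : ∀ z : σ, (z : ℂ) = 0 → (h z : ℂ) = 0)
    (h1 : ∀ (z : σ) i, (z : ℂ) = e i → (h z : ℂ) = e' i) :
    ∃ C : ℝ≥0∞, C ≠ ∞ ∧ ∀ g : τ → ℂ, eBVNorm (g ∘ h) ≤ C * eBVNorm g := by
  classical
  obtain ⟨K, hK, hK'⟩ : ∃ K, k ≤ K ∧ k' ≤ K := ⟨max k k', le_max_left _ _, le_max_right _ _⟩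
  have hcases : ∀ z : σ, (z : ℂ) = 0 ∨ ∃ i, (z : ℂ) = e i := fun z => by
    rcases eq_or_ne (z : ℂ) 0 with hz | hz
    · exact Or.inl hz
    · have : (z : ℂ) ∈ Set.range e := he.range_eq ▸ ⟨z.2, hz⟩
      obtain ⟨i, hi⟩ := this
      exact Or.inr ⟨i, hi.symm⟩
  have hmid : ∀ z : σ, 0 < (z : ℂ).re → (z : ℂ).re < (e K).re → ∃ n, K < n ∧ (z : ℂ) = e n := by
    intro z hz1 hz2
    rcases hcases z with hz | ⟨i, hz⟩
    · rw [hz] at hz1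
      exact absurd hz1 (lt_irrefl 0)
    · refine ⟨i, ?_, hz⟩
      rw [hz] at hz1 hz2
      have hki : k ≤ i := by
        by_contra hc
        exact absurd hz1 (he.neg i (not_le.1 hc)).not_gt
      exact (he.strictAntiOn.lt_iff_gt (a := i) (b := K) hki hK).1 hz2
  have heK : e' K ∈ τ := (he'.range_eq ▸ Set.mem_range_self K : e' K ∈ τ \ {0}).1
  -- The monotone comparison map: it collapses the nonpositive part to `0` and everything from `e K`
  -- rightwards to `e' K`. It differs from `h` at most at `e 0, …, e K`.
  let h' : σ → τ := fun z =>
    if (z : ℂ).re ≤ 0 then ⟨0, hτ.zero_mem⟩ else if (e K).re ≤ (z : ℂ).re then ⟨e' K, heK⟩ else h z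
  refine ACSpace.exists_eBVNorm_comp_le hσ.real hτ.real (h' := h') ?_ (Or.inl fun z w hzw => ?_)
  · refine (((Set.finite_Iic K).image e).preimage Subtype.val_injective.injOn).subset fun z hz => ?_
    rcases hcases z with hz0 | ⟨i, hi⟩
    · exact absurd (Subtype.ext (by simp [h', hz0, h0 z hz0])) hz
    · refine ⟨i, ?_, hi.symm⟩
      by_contra hc
      have hKi : K < i := not_le.1 hc
      refine hz ?_
      have hpos : 0 < (z : ℂ).re := hi ▸ he.pos i (hK.trans hKi.le)
      have hlt : (z : ℂ).re < (e K).re := hi ▸ he.strictAntiOn hK (hK.trans hKi.le) hKi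
      simp only [h', if_neg hpos.not_ge, if_neg hlt.not_ge]
  · have hpos' : ∀ w : σ, 0 < (w : ℂ).re → (w : ℂ).re < (e K).re → 0 ≤ (h w : ℂ).re := by
      intro w hw1 hw2
      obtain ⟨n, hn, hwn⟩ := hmid w hw1 hw2
      rw [h1 w n hwn]
      exact (he'.pos n (hK'.trans hn.le)).le
    by_cases hz0 : (z : ℂ).re ≤ 0
    · simp only [h', if_pos hz0, Complex.zero_re]
      split_ifs with hw0 hw1
      · simp
      · exact (he'.pos K hK').le
      · exact hpos' w (not_le.1 hw0) (not_le.1 hw1)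
    · have hw0 : ¬ (w : ℂ).re ≤ 0 := fun hc => hz0 (hzw.trans hc)
      simp only [h', if_neg hz0, if_neg hw0]
      by_cases hzK : (e K).re ≤ (z : ℂ).re
      · simp only [if_pos hzK, if_pos (hzK.trans hzw), le_refl]
      · obtain ⟨n, hn, hzn⟩ := hmid z (not_le.1 hz0) (not_le.1 hzK)
        simp only [if_neg hzK, h1 z n hzn]
        split_ifs with hwK
        · exact (he'.strictAntiOn hK' (hK'.trans hn.le) hn).le
        · obtain ⟨m, hm, hwm⟩ := hmid w (not_le.1 hw0) (not_le.1 hwK)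
          simp only [h1 w m hwm]
          rw [hzn, hwm] at hzw
          exact he'.strictAntiOn.antitoneOn (hK'.trans hm.le) (hK'.trans hn.le)
            ((he.strictAntiOn.le_iff_ge (a := n) (b := m) (hK.trans hn.le) (hK.trans hm.le)).1 hzw)

/-- Any two real `C`-sets accumulating at `0` from one side only have isomorphic algebras. -/
theorem acIso_of_not_posInfinite_negInfinite (hσ : IsRealCSet σ) (hτ : IsRealCSet τ)
    (hσ' : ¬ (PosInfinite σ ∧ NegInfinite σ)) (hτ' : ¬ (PosInfinite τ ∧ NegInfinite τ)) :
    ACIso σ τ := by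
  have key : ∀ {σ τ : Set ℂ}, IsRealCSet σ → IsRealCSet τ → PosInfinite σ → ¬ NegInfinite σ →
      PosInfinite τ → ¬ NegInfinite τ → ACIso σ τ := by
    intro σ τ hσ hτ hp hn hp' hn'
    obtain ⟨k, e, he⟩ := hσ.exists_isOneSidedEnum hp hn
    obtain ⟨k', e', he'⟩ := hτ.exists_isOneSidedEnum hp' hn'
    obtain ⟨h, h0, h1⟩ := exists_equiv_of_enum hσ.zero_mem hτ.zero_mem he.injective he'.injective
      he.range_eq he'.range_eq
    refine ACIso.of_equiv hσ hτ h h0 (he.exists_eBVNorm_comp_le hσ hτ he' (fun z => (h0 z).1)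
      fun z i => (h1 z i).1) (he'.exists_eBVNorm_comp_le hτ hσ he (fun z hz => ?_) fun z i hz => ?_)
    · exact (h0 _).2 (by rwa [h.apply_symm_apply])
    · exact (h1 _ i).2 (by rwa [h.apply_symm_apply])
  obtain ⟨σ', h1, hp, hn, ⟨f⟩⟩ := hσ.exists_acIso_posInfinite hσ'
  obtain ⟨τ', h1', hp', hn', ⟨f'⟩⟩ := hτ.exists_acIso_posInfinite hτ'
  obtain ⟨g⟩ := key h1 h1' hp hn hp' hn'
  exact ⟨(f.trans g).trans f'.symm⟩

/-! ### One-sided and two-sided sets are not equivalent -/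

/-- Each term is chosen nearer to `0` than the previous one, from `A` and `B` in turn. -/
theorem exists_alternating_seq {A B : Set σ}
    (hA : ∀ ε > 0, ∃ z ∈ A, 0 < (z : ℂ).re ∧ (z : ℂ).re < ε)
    (hB : ∀ ε > 0, ∃ z ∈ B, 0 < (z : ℂ).re ∧ (z : ℂ).re < ε) :
    ∃ z : ℕ → σ, (StrictAnti fun i => (z i : ℂ).re) ∧ (∀ i, Even i → z i ∈ A) ∧
      ∀ i, ¬ Even i → z i ∈ B := by
  classical
  have h : ∀ (i : ℕ) (ε : ℝ), 0 < ε →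
      ∃ z ∈ (if Even i then A else B), 0 < (z : ℂ).re ∧ (z : ℂ).re < ε := fun i ε hε => by
    split_ifs
    · exact hA ε hε
    · exact hB ε hε
  have : Nonempty σ := ⟨(hA 1 one_pos).choose⟩
  choose! F hF1 hF2 hF3 using h
  obtain ⟨z, hz0, hzs⟩ : ∃ z : ℕ → σ, z 0 = F 0 1 ∧ ∀ i, z (i + 1) = F (i + 1) (z i : ℂ).re :=
    ⟨Nat.rec (F 0 1) fun i w => F (i + 1) (w : ℂ).re, rfl, fun _ => rfl⟩
  have hpos : ∀ i, 0 < (z i : ℂ).re := fun i => by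
    induction i with
    | zero => rw [hz0]; exact hF2 0 1 one_pos
    | succ i ih => rw [hzs]; exact hF2 (i + 1) _ ih
  have hmem : ∀ i, z i ∈ (if Even i then A else B) := fun i => by
    cases i with
    | zero => rw [hz0]; exact hF1 0 1 one_pos
    | succ i => rw [hzs]; exact hF1 (i + 1) _ (hpos i)
  refine ⟨z, strictAnti_nat_of_succ_lt fun i => ?_, fun i hi => ?_, fun i hi => ?_⟩
  · rw [hzs]
    exact hF3 (i + 1) _ (hpos i)
  · simpa only [if_pos hi] using hmem i
  · simpa only [if_neg hi] using hmem i

theorem IsRealCSet.exists_small_pos (h : IsRealCSet σ) (hn : ¬ NegInfinite σ) {A : Set σ}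
    (hA : A.Infinite) (ε : ℝ) (hε : 0 < ε) : ∃ z ∈ A, 0 < (z : ℂ).re ∧ (z : ℂ).re < ε := by
  by_contra hc
  push Not at hc
  refine hA ((((h.finite_le_norm hε).union ((Set.not_infinite.1 hn).union
    (Set.finite_singleton 0))).preimage Subtype.val_injective.injOn).subset fun z hz => ?_)
  rcases lt_trichotomy (z : ℂ).re 0 with h0 | h0 | h0
  · exact Or.inr (Or.inl ⟨z.2, h0⟩)
  · exact Or.inr (Or.inr (Complex.ext h0 (h.real z z.2)))
  · exact Or.inl ⟨z.2, (hc z hz h0).trans ((le_abs_self _).trans (Complex.abs_re_le_norm z))⟩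

/-- On `τ` the positive and negative points are separated by one jump. On `σ` their counterparts all
crowd towards `0` from the right, so a decreasing list can visit them alternately as often as
desired. -/
theorem not_acIso (hσ : IsRealCSet σ) (hτ : IsRealCSet τ) (hn : ¬ NegInfinite σ)
    (hp' : PosInfinite τ) (hn' : NegInfinite τ) : ¬ ACIso σ τ := by
  rintro ⟨Φ⟩
  have : Nonempty σ := ⟨⟨0, hσ.zero_mem⟩⟩
  -- The point map is meaningful at nonzero points only; its value at `0` is arbitrary.
  have hH : ∀ y : τ, ∃ x : σ, ∀ hy : (y : ℂ) ≠ 0,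
      ∃ hx : (x : ℂ) ≠ 0, Φ.toAlgEquiv (hσ.acPoint x hx) = hτ.acPoint y hy := fun y => by
    by_cases hy : (y : ℂ) = 0
    · exact ⟨Classical.arbitrary σ, fun hc => absurd hy hc⟩
    · obtain ⟨x, hx⟩ := exists_point_map hσ hτ Φ.toAlgEquiv y hy
      exact ⟨x, fun _ => hx⟩
  choose H hH using hH
  have happly : ∀ (g : AC τ) (y : τ), (y : ℂ) ≠ 0 →
      BV.toFun (Φ.toAlgEquiv.symm g : BV σ) (H y) = BV.toFun (g : BV τ) y := fun g y hy => by
    obtain ⟨hx, he⟩ := hH y hy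
    exact apply_eq_of_map_acPoint hσ hτ Φ.toAlgEquiv he g
  have hinj : Set.InjOn H {y | (y : ℂ) ≠ 0} := fun y hy w hw hyw => by
    by_contra hne
    have h1 := happly (hτ.acPoint w hw) y hy
    rw [hyw, happly _ w hw] at h1
    have h2 : (hτ.point w).toFun w = (hτ.point w).toFun y := h1
    rw [hτ.point_apply_self, hτ.point_apply_of_ne hne] at h2
    exact one_ne_zero h2
  have hnz : ∀ y : τ, (y : ℂ).re ≠ 0 → (y : ℂ) ≠ 0 := fun y hy hc => hy (by rw [hc]; rfl)
  have hA : (H '' {y : τ | 0 < (y : ℂ).re}).Infinite := by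
    refine Set.Infinite.image (hinj.mono fun y hy => hnz y (ne_of_gt hy)) fun hc => ?_
    refine hp' ((hc.image Subtype.val).subset fun z hz => ⟨⟨z, hz.1⟩, hz.2, rfl⟩)
  have hB : (H '' {y : τ | (y : ℂ).re < 0}).Infinite := by
    refine Set.Infinite.image (hinj.mono fun y hy => hnz y (ne_of_lt hy)) fun hc => ?_
    refine hn' ((hc.image Subtype.val).subset fun z hz => ⟨⟨z, hz.1⟩, hz.2, rfl⟩)
  obtain ⟨z, hz, hzA, hzB⟩ := exists_alternating_seq (hσ.exists_small_pos hn hA)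
    (hσ.exists_small_pos hn hB)
  have hy : ∀ i, ∃ y : τ, H y = z i ∧ (Even i → 0 < (y : ℂ).re) ∧ (¬ Even i → (y : ℂ).re < 0) :=
    fun i => by
      by_cases hi : Even i
      · obtain ⟨y, hy, hyz⟩ := hzA i hi
        exact ⟨y, hyz, fun _ => hy, fun hc => absurd hi hc⟩
      · obtain ⟨y, hy, hyz⟩ := hzB i hi
        exact ⟨y, hyz, fun hc => absurd hc hi, fun _ => hy⟩
  choose y hyz hye hyo using hy
  have hynz : ∀ i, (y i : ℂ) ≠ 0 := fun i => by
    by_cases hi : Even i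
    · exact hnz _ (hye i hi).ne'
    · exact hnz _ (hyo i hi).ne
  obtain ⟨C, hC0, hC⟩ := SemilinearMapClass.bound_of_continuous
    (Φ.toAlgEquiv.symm.toLinearMap : AC τ →ₗ[ℂ] AC σ) Φ.symm.continuous_toFun
  have hle : ∀ N : ℕ, (N : ℝ) ≤ C * 3 := by
    intro N
    -- The threshold `δ` lies below the finitely many positive points in use. The step at `δ`,
    -- unlike a step at `0`, has finite support and so belongs to `AC τ`, while its norm is at most
    -- 3 whatever `δ` is.
    obtain ⟨δ, hδ, hδy⟩ : ∃ δ > 0, ∀ i ≤ N, Even i → δ ≤ (y i : ℂ).re := by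
      induction N with
      | zero => exact ⟨(y 0 : ℂ).re, hye 0 Even.zero, fun i hi _ => by rw [Nat.le_zero.1 hi]⟩
      | succ N ih =>
        obtain ⟨δ, hδ, h⟩ := ih
        by_cases hN : Even (N + 1)
        · refine ⟨min δ (y (N + 1) : ℂ).re, lt_min hδ (hye _ hN), fun i hi hie => ?_⟩
          rcases Nat.le_succ_iff.1 hi with hi | rfl
          · exact (min_le_left _ _).trans (h i hi hie)
          · exact min_le_right _ _
        · refine ⟨δ, hδ, fun i hi hie => ?_⟩
          rcases Nat.le_succ_iff.1 hi with hi | rfl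
          · exact h i hi hie
          · exact absurd hie hN
    have hb : eBVNorm (ind fun w : τ => δ ≤ (w : ℂ).re) ≤ 3 :=
      eBVNorm_ind_le hτ.real (Or.inl fun z w h1 h2 => h2.trans h1)
    let g : BV τ := BV.mk _ (hb.trans_lt (by norm_num))
    have hg : g ∈ AC τ := by
      rw [hτ.AC_eq]
      refine Subalgebra.le_topologicalClosure _ (hτ.mem_pointAlgebra_of_finite (fun w hw => ?_) ?_)
      · simp [g, ind, hw, hδ]
      · refine ((hτ.finite_le_norm hδ).preimage Subtype.val_injective.injOn).subset fun w hw => ?_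
        refine ⟨w.2, ?_⟩
        by_contra hc
        refine hw ?_
        have : ¬ δ ≤ (w : ℂ).re := fun h1 =>
          hc (h1.trans ((le_abs_self _).trans (Complex.abs_re_le_norm _)))
        simp [g, ind, this]
    have hgn : ‖g‖ ≤ 3 := BV.norm_le_of_eBVNorm_le (by norm_num) (hb.trans (by norm_num))
    set f : BV σ := (Φ.toAlgEquiv.symm ⟨g, hg⟩).1 with hf
    have hfz : ∀ i ≤ N, f.toFun (z i) = if Even i then 1 else 0 := fun i hi => by
      rw [hf, ← hyz, happly _ _ (hynz i)]
      simp only [g, BV.toFun_mk, ind]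
      by_cases hie : Even i
      · rw [if_pos hie, if_pos (hδy i hi hie)]
      · rw [if_neg hie, if_neg (by linarith [hyo i hie])]
    -- The transported function alternates between 1 and 0 along a decreasing list, whose variation
    -- factor is one.
    have hcv : cvar f.toFun N z = N := by
      have h1 : ∀ i ∈ Finset.range N, ‖f.toFun (z (i + 1)) - f.toFun (z i)‖ₑ = 1 := fun i hi => by
        rw [Finset.mem_range] at hi
        rw [hfz i hi.le, hfz (i + 1) hi]
        by_cases hie : Even i
        · simp [hie, Nat.even_add_one]
        · simp [hie, Nat.even_add_one]
      rw [cvar, Finset.sum_congr rfl h1]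
      simp
    have hNf : (N : ℝ) ≤ ‖f‖ := by
      rw [BV.norm_def, ← ENNReal.toReal_natCast, ← hcv]
      refine ENNReal.toReal_mono f.eBVNorm_lt_top.ne ?_
      exact (cvar_le_var_of_monotone_or_antitone hσ.real _ N (Or.inr hz.antitone)).trans le_add_self
    have hfg : ‖f‖ ≤ C * ‖g‖ := hC ⟨g, hg⟩
    exact hNf.trans (hfg.trans (by gcongr))
  obtain ⟨N, hN⟩ := exists_nat_gt (C * 3)
  exact absurd (hle N) hN.not_ge

/-! ### Examples -/

/-- Supplies the examples showing that both classes occur. Only finitely many terms of a null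
sequence stay away from `0`, and injectivity makes the set infinite. -/
theorem isRealCSet_insert_range {u : ℕ → ℝ} (hu : Filter.Tendsto u Filter.atTop (nhds 0))
    (hinj : Function.Injective u) : IsRealCSet (insert 0 (Set.range fun n => (u n : ℂ))) := by
  have hu' : Filter.Tendsto (fun n => (u n : ℂ)) Filter.atTop (nhds 0) := by
    simpa [Function.comp_def] using (Complex.continuous_ofReal.tendsto 0).comp hu
  have hinj' : Function.Injective fun n => (u n : ℂ) := Complex.ofReal_injective.comp hinj
  have hinf : (Set.range fun n => (u n : ℂ)).Infinite := Set.infinite_range_of_injective hinj'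
  have hcpt := hu'.isCompact_insert_range
  have hacc : ∀ z : ℂ, AccPt z (Filter.principal (insert 0 (Set.range fun n => (u n : ℂ)))) →
      z = 0 := by
    intro z hz
    by_contra hz0
    have hU : {w : ℂ | ‖z‖ / 2 < ‖w‖} ∈ nhds z :=
      (isOpen_lt continuous_const continuous_norm).mem_nhds
        (half_lt_self (norm_pos_iff.2 hz0))
    refine Set.Infinite.of_accPt (hz.nhds_inter hU) ?_
    obtain ⟨N, hN⟩ := Filter.eventually_atTop.1
      (hu'.norm.eventually (gt_mem_nhds (show ‖(0 : ℂ)‖ < ‖z‖ / 2 by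
        simpa using hz0)))
    refine ((Set.finite_lt_nat N).image fun n => (u n : ℂ)).subset ?_
    rintro w ⟨hw, rfl | ⟨n, rfl⟩⟩
    · have : ‖z‖ / 2 < 0 := by simpa using hw
      linarith [norm_nonneg z]
    · refine ⟨n, ?_, rfl⟩
      by_contra hc
      exact lt_asymm hw (hN n (not_lt.1 hc))
  refine ⟨⟨hcpt, (Set.countable_range _).insert 0, hinf.mono (Set.subset_insert _ _),
    fun z => ⟨hacc z, ?_⟩⟩, ?_⟩
  · rintro rfl
    obtain ⟨w, -, hw⟩ := (hinf.mono (Set.subset_insert 0 _)).exists_accPt_of_subset_isCompact hcpt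
      subset_rfl
    rwa [hacc w hw] at hw
  · rintro z (rfl | ⟨n, rfl⟩) <;> simp

theorem exists_isRealCSet_not_two_sided :
    ∃ σ, IsRealCSet σ ∧ ¬ (PosInfinite σ ∧ NegInfinite σ) := by
  refine ⟨_, isRealCSet_insert_range tendsto_one_div_add_atTop_nhds_zero_nat fun n m hnm => ?_,
    fun h => h.2 ?_⟩
  · simpa using hnm
  · convert Set.finite_empty
    refine Set.eq_empty_of_forall_notMem ?_
    rintro z ⟨rfl | ⟨n, rfl⟩, hz⟩
    · simp at hz
    · rw [Complex.ofReal_re] at hz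
      have : (0 : ℝ) < 1 / ((n : ℝ) + 1) := by positivity
      linarith

/-- The example is `0` together with the points `(-1)^n / (n + 1)`: even indices give the positive
points, odd ones the negative. -/
theorem exists_isRealCSet_two_sided :
    ∃ σ, IsRealCSet σ ∧ (PosInfinite σ ∧ NegInfinite σ) := by
  have habs : ∀ n : ℕ, |(-1 : ℝ) ^ n * (1 / ((n : ℝ) + 1))| = 1 / ((n : ℝ) + 1) := fun n => by
    rw [abs_mul, abs_pow, abs_neg, abs_one, one_pow, one_mul, abs_of_pos (by positivity)]
  have hinj : Function.Injective fun n : ℕ => (-1 : ℝ) ^ n * (1 / ((n : ℝ) + 1)) := by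
    intro n m hnm
    have := congrArg abs hnm
    simp only [habs] at this
    simpa using this
  have ht : Filter.Tendsto (fun n : ℕ => (-1 : ℝ) ^ n * (1 / ((n : ℝ) + 1))) Filter.atTop
      (nhds 0) := by
    rw [tendsto_zero_iff_abs_tendsto_zero]
    exact tendsto_one_div_add_atTop_nhds_zero_nat.congr fun n => (habs n).symm
  refine ⟨_, isRealCSet_insert_range ht hinj, ?_, ?_⟩
  · refine (Set.infinite_range_of_injective (f := fun n : ℕ =>
      (((-1 : ℝ) ^ (2 * n) * (1 / (((2 * n : ℕ) : ℝ) + 1)) : ℝ) : ℂ)) fun n m hnm => ?_).mono ?_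
    · have := hinj (Complex.ofReal_injective hnm)
      omega
    · rintro _ ⟨n, rfl⟩
      refine ⟨Or.inr ⟨2 * n, rfl⟩, ?_⟩
      rw [Complex.ofReal_re, pow_mul, neg_one_sq, one_pow, one_mul]
      positivity
  · refine (Set.infinite_range_of_injective (f := fun n : ℕ =>
      (((-1 : ℝ) ^ (2 * n + 1) * (1 / (((2 * n + 1 : ℕ) : ℝ) + 1)) : ℝ) : ℂ))
        fun n m hnm => ?_).mono ?_
    · have := hinj (Complex.ofReal_injective hnm)
      omega
    · rintro _ ⟨n, rfl⟩
      refine ⟨Or.inr ⟨2 * n + 1, rfl⟩, ?_⟩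
      rw [Complex.ofReal_re, pow_succ, pow_mul, neg_one_sq, one_pow, one_mul, neg_one_mul,
        neg_lt_zero]
      positivity

/-! ### Assembling the classification -/

theorem acIso_iff (hσ : IsRealCSet σ) (hτ : IsRealCSet τ) :
    ACIso σ τ ↔ ((PosInfinite σ ∧ NegInfinite σ) ↔ (PosInfinite τ ∧ NegInfinite τ)) := by
  have key : ∀ {σ τ : Set ℂ}, IsRealCSet σ → IsRealCSet τ → ¬ (PosInfinite σ ∧ NegInfinite σ) →
      (PosInfinite τ ∧ NegInfinite τ) → ¬ ACIso σ τ := by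
    rintro σ τ hσ hτ h1 h2 ⟨f⟩
    obtain ⟨ρ, hρ, -, hn, ⟨g⟩⟩ := hσ.exists_acIso_posInfinite h1
    exact not_acIso hρ hτ hn h2.1 h2.2 ⟨g.symm.trans f⟩
  by_cases h1 : PosInfinite σ ∧ NegInfinite σ <;> by_cases h2 : PosInfinite τ ∧ NegInfinite τ
  · exact iff_of_true (acIso_of_posInfinite_negInfinite hσ hτ h1 h2) (iff_of_true h1 h2)
  · exact iff_of_false (fun ⟨f⟩ => key hτ hσ h2 h1 ⟨f.symm⟩) fun hc => h2 (hc.1 h1)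
  · exact iff_of_false (key hσ hτ h1 h2) fun hc => h1 (hc.2 h2)
  · exact iff_of_true (acIso_of_not_posInfinite_negInfinite hσ hτ h1 h2) (iff_of_false h1 h2)

end ACSpace

theorem mainTheorem3 :
    Nat.card (Quotient ACSpace.realCSetSetoid) = 2 ∧
    (∀ σ : Set ℂ, ACSpace.IsRealCSet σ →
      Xor (ACSpace.IsRaySet 1 σ) (ACSpace.IsRaySet 2 σ)) ∧
    (∀ σ τ : Set ℂ, ACSpace.IsRealCSet σ → ACSpace.IsRealCSet τ →
      (ACSpace.ACIso σ τ ↔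
        (ACSpace.IsRaySet 1 σ ∧ ACSpace.IsRaySet 1 τ) ∨
        (ACSpace.IsRaySet 2 σ ∧ ACSpace.IsRaySet 2 τ))) := by
  refine ⟨?_, fun σ hσ => ?_, fun σ τ hσ hτ => ?_⟩
  · obtain ⟨σ, hσ, h1⟩ := ACSpace.exists_isRealCSet_not_two_sided
    obtain ⟨τ, hτ, h2⟩ := ACSpace.exists_isRealCSet_two_sided
    -- The two classes are those of the one-sided and of the two-sided example; by `acIso_iff` they
    -- differ and every real `C`-set falls into one of them.
    rw [Nat.card_eq_two_iff]
    refine ⟨Quotient.mk _ ⟨σ, hσ⟩, Quotient.mk _ ⟨τ, hτ⟩, fun hc => ?_, ?_⟩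
    · have h : ACSpace.ACIso σ τ := Quotient.exact hc
      exact h1 (((ACSpace.acIso_iff hσ hτ).1 h).2 h2)
    · refine Set.eq_univ_of_forall fun q => ?_
      induction q using Quotient.inductionOn with
      | h ρ =>
        by_cases h : ACSpace.PosInfinite ρ.1 ∧ ACSpace.NegInfinite ρ.1
        · exact Or.inr (Quotient.sound ((ACSpace.acIso_iff ρ.2 hτ).2 (iff_of_true h h2)))
        · exact Or.inl (Quotient.sound ((ACSpace.acIso_iff ρ.2 hσ).2 (iff_of_false h h1)))
  · rw [hσ.isRaySet_one_iff, hσ.isRaySet_two_iff]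
    by_cases h : ACSpace.PosInfinite σ ∧ ACSpace.NegInfinite σ
    · exact Or.inr ⟨h, not_not.2 h⟩
    · exact Or.inl ⟨h, h⟩
  · rw [ACSpace.acIso_iff hσ hτ, hσ.isRaySet_one_iff, hσ.isRaySet_two_iff, hτ.isRaySet_one_iff,
      hτ.isRaySet_two_iff]
    tauto
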